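/- **Setting.** There are items $[I]=\{1,\dots,I\}$ and states $[S]=\{1,\dots,S\}$. Item $i$ is in state $s\in[S]$ with known probability $p_i(s)$, where $p_i(s)\ge 0$ and $\sum_s p_i(s)=1$, independently over the items; $\phi\in[S]^{[I]}$ is the random vector of states. Picking item $i$ in state $s$ costs $c_i(s)\ge 0$, where $c_i$ is non-decreasing in $s$, and the budget is $B\ge 0$. Every state that occurs is affordable on its own: $c_i(s)\le B$ whenever $p_i(s)>0$. Let $f:\{0,1,\dots,S\}^{[I]}\to\mathbb{R}_{\ge 0}$ be monotone and lattice-submodular, i.e. $f(u\vee s\mathbf 1_i)-f(u)\ge f(v\vee s\mathbf 1_i)-f(v)$ for all $u\le v$, all $i\in[I]$ and all states $s$. For $U\subseteq[I]\times[S]$ let $h(U)=f(u)$ with $u(i)=\max\{s:(i,s)\in U\}$, and $u(i)=0$ if there is no such $s$. **Policies.** An adaptive policy $\pi$ (deterministic, or randomized with finitely many coin tosses) probes items one after another, each at most once, choosing the next item from the observations made so far. When it probes an item it observes its state and must immediately and irrevocably pick or reject the item. Let $G(\pi,\phi)\subseteq[I]\times[S]$ be the (possibly random) set of picked item-state pairs.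 The policy is feasible if, for every $\phi\in[S]^{[I]}$ and every possible outcome of its coin tosses, $\sum_{(i,s)\in G(\pi,\phi)}c_i(s)\le B$. Its expected utility is $f(\pi)=\mathbb E[h(G(\pi,\phi))]$. **Algorithm StoCan.** *Phase 1 (continuous greedy).* Let $\delta=1/(IS)^2$ and start with the $I\times S$ matrix $\mathbf y=\mathbf 0$. Repeat $1/\delta=(IS)^2$ times (no rounds if $I=0$): let $R$ contain each $(i,s)$ independently with probability $y_{is}$; set $\omega_{is}=\mathbb E[h(R\cup\{(i,s)\})]-\mathbb E[h(R)]$; let $\mathbf x^{LP}$ be any optimal solution of the linear program $$\max \sum_{i,s}\omega_{is}x_{is}\quad\text{subject to}\quad 0\le x_{is}\le p_i(s)\ \text{ for all } (i,s),\qquad \sum_{i,s}c_i(s)x_{is}\le B;$$ and replace $\mathbf y$ by $\mathbf y+\delta\,\mathbf x^{LP}$. *Phase 2.* With probability $1/2$ each, run $\pi^{small}$ or $\pi^{large}$ with the final $\mathbf y$. Both probe the items $1,\dots,I$ in this order. When item $i$ is seen in state $s$, $\pi^{small}$ rejects it if $c_i(s)>B/2$, and $\pi^{large}$ rejects it if $c_i(s)\le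 B/2$. Otherwise, if the remaining budget is at least $c_i(s)$, the item is picked with probability $y_{is}/(4p_i(s))$, and if not, it is rejected. **Theorem.** The optimal solutions used in Phase 1 exist, and for every choice of them StoCan is a feasible adaptive policy, and its expected utility is at least $$\frac{1-1/e}{16}\,f(\pi)$$ for every feasible adaptive policy $\pi$, in particular for the optimal one $\pi^*$. -/

import Mathlib

namespace StochProbing

open Finset

/-! Items are the elements of `Fin I`. The `S` states `1, …, S` are represented by `Fin S`, the
element `s : Fin S` standing for the state `s + 1`, that is `s.succ : Fin (S + 1)`. State vectors
with the value `0` allowed ("item absent") are functions `Fin I → Fin (S + 1)`, with the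
coordinatewise order and lattice operations. -/

/-- Lattice submodularity: the gain of joining `s · 1_i` is non-increasing in the vector. -/
def LatticeSubmodular {I S : ℕ} (f : (Fin I → Fin (S + 1)) → ℝ) : Prop :=
  ∀ u v : Fin I → Fin (S + 1), u ≤ v → ∀ (i : Fin I) (s : Fin (S + 1)),
    f (v ⊔ Pi.single i s) - f v ≤ f (u ⊔ Pi.single i s) - f u

/-- The vector of a set `U` of item-state pairs: the largest state occurring with the item `i`,
and `0` if there is none. -/
noncomputable def vec {I S : ℕ} (U : Finset (Fin I × Fin S)) (i : Fin I) : Fin (S + 1) :=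
  (U.filter fun e => e.1 = i).sup fun e => e.2.succ

/-- The set function on item-state pairs induced by `f`. -/
noncomputable def setFun {I S : ℕ} (f : (Fin I → Fin (S + 1)) → ℝ) (U : Finset (Fin I × Fin S)) : ℝ :=
  f (vec U)

/-- Expectation of `g R`, where the random set `R` contains each pair `(i, s)` independently with
probability `y i s`. For `g = h` this is the multilinear extension of `h` at `y`. -/
noncomputable def expect {I S : ℕ} (y : Fin I → Fin S → ℝ)
    (g : Finset (Fin I × Fin S) → ℝ) : ℝ :=
  ∑ U : Finset (Fin I × Fin S), (∏ e ∈ U, y e.1 e.2) * (∏ e ∈ Uᶜ, (1 - y e.1 e.2)) * g U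

/-! ### The linear program and continuous greedy -/

/-- Feasible points of the linear program. -/
def LPFeasible {I S : ℕ} (p c : Fin I → Fin S → ℝ) (B : ℝ) (x : Fin I → Fin S → ℝ) : Prop :=
  (∀ i s, 0 ≤ x i s ∧ x i s ≤ p i s) ∧ ∑ i, ∑ s, x i s * c i s ≤ B

/-- Optimal solutions of the linear program with objective weights `w`. -/
def LPOptimal {I S : ℕ} (p c : Fin I → Fin S → ℝ) (B : ℝ) (w x : Fin I → Fin S → ℝ) : Prop :=
  LPFeasible p c B x ∧
    ∀ x', LPFeasible p c B x' → ∑ i, ∑ s, w i s * x' i s ≤ ∑ i, ∑ s, w i s * x i s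

/-- The weight of `(i, s)` at the fractional point `y`: `E[h(R ∪ {(i, s)})] - E[h(R)]`. -/
noncomputable def weight {I S : ℕ} (f : (Fin I → Fin (S + 1)) → ℝ) (y : Fin I → Fin S → ℝ)
    (i : Fin I) (s : Fin S) : ℝ :=
  expect y (fun U => setFun f (insert (i, s) U)) - expect y (setFun f)

/-- `y` is a possible output of continuous greedy with step `δ = 1 / (I S)²`: it is reached from
`0` in `1 / δ = (I S)²` rounds, each adding `δ` times some optimal solution of the linear program
for the current weights (ties are broken arbitrarily). -/
def ContinuousGreedyOutput {I S : ℕ} (f : (Fin I → Fin (S + 1)) → ℝ)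
    (p c : Fin I → Fin S → ℝ) (B : ℝ) (y : Fin I → Fin S → ℝ) : Prop :=
  ∃ Y : ℕ → Fin I → Fin S → ℝ,
    (∀ i s, Y 0 i s = 0) ∧
    (∀ k < (I * S) ^ 2, ∃ x : Fin I → Fin S → ℝ, LPOptimal p c B (weight f (Y k)) x ∧
      ∀ i s, Y (k + 1) i s = Y k i s + 1 / ((I : ℝ) * (S : ℝ)) ^ 2 * x i s) ∧
    y = Y ((I * S) ^ 2)

/-! ### Adaptive probing policies -/

/-- Adaptive, possibly randomized, probing policies as decision trees. `coin q a b` continues as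
`a` with probability `q` and as `b` otherwise. `probe i q next` probes item `i`; on observing its
state `s`, it immediately picks `i` with probability `q s` and rejects it otherwise, and continues
as `next s true` or `next s false` accordingly. Deterministic policies are the trees whose
probabilities are all `0` or `1`. -/
inductive Policy (I S : ℕ) : Type where
  | halt : Policy I S
  | coin (q : ℝ) (a b : Policy I S) : Policy I S
  | probe (i : Fin I) (q : Fin S → ℝ) (next : Fin S → Bool → Policy I S) : Policy I S

namespace Policy

variable {I S : ℕ}

/-- The probabilities lie in `[0, 1]`, and no item is probed twice (nor one of the set `A` of items
already probed), so that rejections are irrevocable. -/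
def AdmissibleFrom : Policy I S → Finset (Fin I) → Prop
  | halt, _ => True
  | coin q a b, A => (0 ≤ q ∧ q ≤ 1) ∧ a.AdmissibleFrom A ∧ b.AdmissibleFrom A
  | probe i q next, A =>
      i ∉ A ∧ (∀ s, 0 ≤ q s ∧ q s ≤ 1) ∧ ∀ s d, (next s d).AdmissibleFrom (insert i A)

/-- A genuine policy: started with no item probed. -/
def Admissible (π : Policy I S) : Prop := π.AdmissibleFrom ∅

/-- Expected value, over the internal randomness of the policy, of `g` of the final set of picked
pairs, when the states of the items are `φ` and `G` has been picked so far. -/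
noncomputable def value (φ : Fin I → Fin S) (g : Finset (Fin I × Fin S) → ℝ) :
    Policy I S → Finset (Fin I × Fin S) → ℝ
  | halt, G => g G
  | coin q a b, G => q * value φ g a G + (1 - q) * value φ g b G
  | probe i q next, G =>
      q (φ i) * value φ g (next (φ i) true) (insert (i, φ i) G) +
        (1 - q (φ i)) * value φ g (next (φ i) false) G

/-- The final sets of picked pairs that occur with positive probability when the states of the
items are `φ` and `G` has been picked so far. -/
def outcomes (φ : Fin I → Fin S) :
    Policy I S → Finset (Fin I × Fin S) → Set (Finset (Fin I × Fin S))
  | halt, G => {G}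
  | coin q a b, G => {U | (q ≠ 0 ∧ U ∈ outcomes φ a G) ∨ (q ≠ 1 ∧ U ∈ outcomes φ b G)}
  | probe i q next, G =>
      {U | (q (φ i) ≠ 0 ∧ U ∈ outcomes φ (next (φ i) true) (insert (i, φ i) G)) ∨
        (q (φ i) ≠ 1 ∧ U ∈ outcomes φ (next (φ i) false) G)}

/-- Feasibility: whatever the states of the items are, the picked pairs cost at most `B`. -/
def Feasible (c : Fin I → Fin S → ℝ) (B : ℝ) (π : Policy I S) : Prop :=
  ∀ φ : Fin I → Fin S, ∀ U ∈ outcomes φ π ∅, ∑ e ∈ U, c e.1 e.2 ≤ B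

/-- Expected utility, the states being drawn from the product distribution with marginals `p`. -/
noncomputable def utility (f : (Fin I → Fin (S + 1)) → ℝ) (p : Fin I → Fin S → ℝ)
    (π : Policy I S) : ℝ :=
  ∑ φ : Fin I → Fin S, (∏ i, p i (φ i)) * value φ (setFun f) π ∅

end Policy

/-! ### The algorithm -/

open Classical in
/-- Probe the listed items in order with remaining budget `b`. If the observed pair `(i, s)`
satisfies `keep` and its cost is at most the remaining budget, pick it with probability
`y i s / (4 p i s)`; otherwise discard it. -/
noncomputable def scan {I S : ℕ} (p c y : Fin I → Fin S → ℝ) (keep : Fin I → Fin S → Prop) :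
    List (Fin I) → ℝ → Policy I S
  | [], _ => Policy.halt
  | i :: l, b =>
      Policy.probe i (fun s => if keep i s ∧ c i s ≤ b then y i s / (4 * p i s) else 0)
        (fun s picked => scan p c y keep l (if picked = true then b - c i s else b))

/-- The policy that discards the pairs of cost larger than `B / 2`. -/
noncomputable def smallPolicy {I S : ℕ} (p c : Fin I → Fin S → ℝ) (B : ℝ)
    (y : Fin I → Fin S → ℝ) : Policy I S :=
  scan p c y (fun i s => c i s ≤ B / 2) (List.finRange I) B

/-- The policy that discards the pairs of cost at most `B / 2`. -/
noncomputable def largePolicy {I S : ℕ} (p c : Fin I → Fin S → ℝ) (B : ℝ)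
    (y : Fin I → Fin S → ℝ) : Policy I S :=
  scan p c y (fun i s => B / 2 < c i s) (List.finRange I) B

/-- StoCan with fractional solution `y`: each of the two policies with probability `1 / 2`. -/
noncomputable def stoCan {I S : ℕ} (p c : Fin I → Fin S → ℝ) (B : ℝ)
    (y : Fin I → Fin S → ℝ) : Policy I S :=
  Policy.coin (1 / 2) (smallPolicy p c B y) (largePolicy p c B y)

end StochProbing

/-!
The argument has two halves, joined by the quantity `4 F(y / 4)`, where `F` is the multilinear
extension of the set function `h` on item-state pairs.

*Continuous greedy.* A feasible adaptive policy picks pairs with probabilities that satisfy the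
linear program, and by submodularity its utility is at most `F(y)` plus the value of these
probabilities under the weights at `y`, for every `y` (`Policy.utility_le_of_lpOptimal`). Hence the
direction chosen in each round is worth at least the missing value. In the usual analysis, of
`F(y)` itself, the discretization costs a lower-order term. Tracking `4 F(y / 4)`, which is at
least `F(y)` by concavity, avoids this: the gradient after the step is evaluated at
`(y + d x) / 4`, which is below `y` except in coordinates where the increment is larger than all
earlier ones, and there the excess is at most an amount that telescopes over the rounds
(`SetSubmodular.greedy_step`). The second-order term in `1 - t ≤ exp (- t - t ^ 2 / 2)` pays for
that amount, so that the full factor `1 - 1 / e` is obtained (`ContinuousGreedyOutput.value_ge`).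

*Rounding.* Without the budget, either policy would pick each pair it keeps with probability
`y / 4`, at most one state per item, which is worth at least independent sampling
(`bernoulliExp_le_exclusiveExp`). The budget stops the small policy only if more than `B / 2` is
spent, and the large policy only after a pick; by Markov's inequality either happens with
probability at most `1 / 2`. Since `f` is lattice submodular and the costs are monotone, both the
gain of the next items and the event that the budget still suffices decrease in the states, so the
two are positively correlated, and at least half of the value survives. This is proved by an
induction along the items with Chebyshev's sum inequality for a single item (`scanUtility_ge`).
The small and large parts together are worth at least `F(y / 4)` by subadditivity. With the factor
`1 / 2` for the choice between the policies, StoCan has utility at least `F(y / 4) / 4`, which is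
`1 / 16` of `4 F(y / 4)`.
-/

namespace StochProbing

open Finset

/-! ### The multilinear extension of a submodular set function -/

section Bernoulli

variable {α : Type*} [DecidableEq α]

/-- Submodularity of a set function: marginal gains are non-increasing. -/
def SetSubmodular (g : Finset α → ℝ) : Prop :=
  ∀ U V : Finset α, U ⊆ V → ∀ e, g (insert e V) - g V ≤ g (insert e U) - g U

lemma SetSubmodular.marginal_antitone {g : Finset α → ℝ} (hg : SetSubmodular g) (e : α) :
    Antitone fun U : Finset α => g (insert e U) - g (U.erase e) := by
  intro U V hUV
  have h := hg _ _ (erase_subset_erase e hUV) e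
  have hi : ∀ U : Finset α, insert e (U.erase e) = insert e U := fun U => by
    ext a; by_cases ha : a = e <;> simp [ha]
  simpa only [hi] using h

lemma SetSubmodular.union_le {g : Finset α → ℝ} (hg : SetSubmodular g) (U V : Finset α) :
    g (V ∪ U) ≤ g U + ∑ e ∈ V, (g (insert e U) - g U) := by
  induction V using Finset.induction_on with
  | empty => simp
  | insert e V he ih =>
    rw [sum_insert he, insert_union]
    linarith [hg U (V ∪ U) subset_union_right e]

variable [Fintype α]

/-- Expectation of `g R`, where the random set `R` contains each `e` independently with
probability `y e`: the multilinear extension of `g` at `y`. -/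
noncomputable def bernoulliExp (y : α → ℝ) (g : Finset α → ℝ) : ℝ :=
  ∑ U : Finset α, (∏ e ∈ U, y e) * (∏ e ∈ Uᶜ, (1 - y e)) * g U

/-- Conditioning on whether `e` belongs to the random set. The weights do not involve `y e`. -/
lemma bernoulliExp_split (y : α → ℝ) (g : Finset α → ℝ) (e : α) :
    bernoulliExp y g = ∑ U ∈ (univ.erase e).powerset,
      (∏ a ∈ U, y a) * (∏ a ∈ univ.erase e \ U, (1 - y a)) *
        ((1 - y e) * g U + y e * g (insert e U)) := by
  have h1 : bernoulliExp y g = ∑ U ∈ (insert e (univ.erase e)).powerset,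
      (∏ a ∈ U, y a) * (∏ a ∈ Uᶜ, (1 - y a)) * g U := by
    rw [insert_erase (mem_univ e), powerset_univ]; rfl
  rw [h1, sum_powerset_insert (notMem_erase e univ), ← sum_add_distrib]
  refine sum_congr rfl fun U hU => ?_
  have heU : e ∉ U := fun h => notMem_erase e univ (mem_powerset.1 hU h)
  have h2 : Uᶜ = insert e (univ.erase e \ U) := by
    ext a; by_cases ha : a = e <;> simp [ha, heU]
  have h3 : (insert e U)ᶜ = univ.erase e \ U := by
    ext a; by_cases ha : a = e <;> simp [ha]
  rw [h2, h3, prod_insert heU, prod_insert (by simp)]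
  ring

lemma bernoulliExp_add (y : α → ℝ) (g g' : Finset α → ℝ) :
    bernoulliExp y (fun U => g U + g' U) = bernoulliExp y g + bernoulliExp y g' := by
  simp only [bernoulliExp, mul_add, sum_add_distrib]

lemma bernoulliExp_sub (y : α → ℝ) (g g' : Finset α → ℝ) :
    bernoulliExp y (fun U => g U - g' U) = bernoulliExp y g - bernoulliExp y g' := by
  simp only [bernoulliExp, mul_sub, sum_sub_distrib]

lemma bernoulliExp_sum {ι : Type*} (s : Finset ι) (y : α → ℝ) (g : ι → Finset α → ℝ) :
    bernoulliExp y (fun U => ∑ i ∈ s, g i U) = ∑ i ∈ s, bernoulliExp y (g i) := by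
  simp only [bernoulliExp, mul_sum]
  exact sum_comm

lemma bernoulliExp_const (y : α → ℝ) (C : ℝ) : bernoulliExp y (fun _ => C) = C := by
  have h := Finset.prod_add y (fun e => 1 - y e) univ
  simp only [add_sub_cancel, prod_const_one, powerset_univ] at h
  simp only [bernoulliExp, ← sum_mul, compl_eq_univ_sdiff, ← h, one_mul]

lemma bernoulliExp_mono {y : α → ℝ} (h0 : 0 ≤ y) (h1 : y ≤ 1) {g g' : Finset α → ℝ}
    (hg : ∀ U, g U ≤ g' U) : bernoulliExp y g ≤ bernoulliExp y g' :=
  sum_le_sum fun U _ => mul_le_mul_of_nonneg_left (hg U) <|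
    mul_nonneg (prod_nonneg fun e _ => h0 e) (prod_nonneg fun e _ => sub_nonneg.2 (h1 e))

lemma bernoulliExp_nonneg {y : α → ℝ} (h0 : 0 ≤ y) (h1 : y ≤ 1) {g : Finset α → ℝ}
    (hg : ∀ U, 0 ≤ g U) : 0 ≤ bernoulliExp y g := by
  simpa only [bernoulliExp_const] using bernoulliExp_mono h0 h1 (g := fun _ => 0) hg

lemma bernoulliExp_insert (y : α → ℝ) (g : Finset α → ℝ) (e : α) :
    bernoulliExp y (fun U => g (insert e U)) = ∑ U ∈ (univ.erase e).powerset,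
      (∏ a ∈ U, y a) * (∏ a ∈ univ.erase e \ U, (1 - y a)) * g (insert e U) := by
  rw [bernoulliExp_split y _ e]
  refine sum_congr rfl fun U _ => ?_
  rw [insert_idem]; ring

lemma bernoulliExp_erase (y : α → ℝ) (g : Finset α → ℝ) (e : α) :
    bernoulliExp y (fun U => g (U.erase e)) = ∑ U ∈ (univ.erase e).powerset,
      (∏ a ∈ U, y a) * (∏ a ∈ univ.erase e \ U, (1 - y a)) * g U := by
  rw [bernoulliExp_split y _ e]
  refine sum_congr rfl fun U hU => ?_
  have heU : e ∉ U := fun h => notMem_erase e univ (mem_powerset.1 hU h)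
  rw [erase_insert heU, erase_eq_of_notMem heU]; ring

lemma bernoulliExp_eq_insert_erase (y : α → ℝ) (g : Finset α → ℝ) (e : α) :
    bernoulliExp y g = y e * bernoulliExp y (fun U => g (insert e U)) +
      (1 - y e) * bernoulliExp y (fun U => g (U.erase e)) := by
  rw [bernoulliExp_insert, bernoulliExp_erase, bernoulliExp_split y g e, mul_sum, mul_sum,
    ← sum_add_distrib]
  exact sum_congr rfl fun U _ => by ring

/-- The partial derivative in direction `e` of the multilinear extension of `g`. -/
noncomputable def gradient (g : Finset α → ℝ) (e : α) (y : α → ℝ) : ℝ :=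
  bernoulliExp y fun U => g (insert e U) - g (U.erase e)

/-- The multilinear extension is affine in each coordinate. -/
lemma bernoulliExp_update (y : α → ℝ) (g : Finset α → ℝ) (e : α) (t : ℝ) :
    bernoulliExp (Function.update y e t) g = bernoulliExp y g + (t - y e) * gradient g e y := by
  rw [gradient, bernoulliExp_sub, bernoulliExp_insert, bernoulliExp_erase,
    bernoulliExp_split y g e, bernoulliExp_split _ g e, ← sum_sub_distrib, mul_sum,
    ← sum_add_distrib]
  refine sum_congr rfl fun U hU => ?_
  have heU : e ∉ U := fun h => notMem_erase e univ (mem_powerset.1 hU h)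
  have h1 : ∏ a ∈ U, Function.update y e t a = ∏ a ∈ U, y a :=
    prod_congr rfl fun a ha => Function.update_of_ne (ne_of_mem_of_not_mem ha heU) _ _
  have h2 : ∏ a ∈ univ.erase e \ U, (1 - Function.update y e t a) =
      ∏ a ∈ univ.erase e \ U, (1 - y a) :=
    prod_congr rfl fun a ha => by
      rw [Function.update_of_ne (ne_of_mem_erase (mem_sdiff.1 ha).1)]
  rw [h1, h2, Function.update_self]
  ring

lemma bernoulliExp_erase_of_eq_zero {y : α → ℝ} (g : Finset α → ℝ) {e : α} (he : y e = 0) :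
    bernoulliExp y (fun U => g (U.erase e)) = bernoulliExp y g := by
  rw [bernoulliExp_eq_insert_erase y g e, he]; ring

/-- Passing from `a` to `b` on the coordinates in `T` one coordinate at a time. -/
lemma bernoulliExp_piecewise_insert (a b : α → ℝ) (g : Finset α → ℝ) {T : Finset α} {e : α}
    (he : e ∉ T) :
    bernoulliExp ((insert e T).piecewise b a) g =
      bernoulliExp (T.piecewise b a) g + (b e - a e) * gradient g e (T.piecewise b a) := by
  rw [piecewise_insert, bernoulliExp_update, piecewise_eq_of_notMem _ _ _ he]

lemma bernoulliExp_antitone {a b : α → ℝ} (ha : 0 ≤ a) (hab : a ≤ b) (hb : b ≤ 1)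
    {g : Finset α → ℝ} (hg : Antitone g) : bernoulliExp b g ≤ bernoulliExp a g := by
  suffices h : ∀ T : Finset α, bernoulliExp (T.piecewise b a) g ≤ bernoulliExp a g by
    simpa using h univ
  intro T
  induction T using Finset.induction_on with
  | empty => simp
  | insert e T he ih =>
    rw [bernoulliExp_piecewise_insert a b g he]
    have h : gradient g e (T.piecewise b a) ≤ 0 := by
      rw [← bernoulliExp_const (T.piecewise b a) 0]
      exact bernoulliExp_mono (ha.trans (le_piecewise_of_le_of_le _ hab le_rfl))
        ((piecewise_le_of_le_of_le _ le_rfl hab).trans hb)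
        fun U => sub_nonpos.2 (hg ((erase_subset e U).trans (subset_insert e U)))
    nlinarith [mul_nonneg (sub_nonneg.2 (hab e)) (neg_nonneg.2 h)]

lemma SetSubmodular.gradient_antitone {g : Finset α → ℝ} (hg : SetSubmodular g) (e : α)
    {a b : α → ℝ} (ha : 0 ≤ a) (hab : a ≤ b) (hb : b ≤ 1) : gradient g e b ≤ gradient g e a :=
  bernoulliExp_antitone ha hab hb (hg.marginal_antitone e)

/-- Concavity along non-negative directions, tangent at the lower end. -/
lemma SetSubmodular.bernoulliExp_le_tangent {g : Finset α → ℝ} (hg : SetSubmodular g)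
    {a b : α → ℝ} (ha : 0 ≤ a) (hab : a ≤ b) (hb : b ≤ 1) :
    bernoulliExp b g ≤ bernoulliExp a g + ∑ e, (b e - a e) * gradient g e a := by
  suffices h : ∀ T : Finset α, bernoulliExp (T.piecewise b a) g ≤
      bernoulliExp a g + ∑ e ∈ T, (b e - a e) * gradient g e a by simpa using h univ
  intro T
  induction T using Finset.induction_on with
  | empty => simp
  | insert e T he ih =>
    rw [bernoulliExp_piecewise_insert a b g he, sum_insert he]
    have h := hg.gradient_antitone e ha (le_piecewise_of_le_of_le T hab le_rfl)
      ((piecewise_le_of_le_of_le T le_rfl hab).trans hb)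
    linarith [mul_le_mul_of_nonneg_left h (sub_nonneg.2 (hab e))]

/-- Concavity along non-negative directions, tangent at the upper end. -/
lemma SetSubmodular.tangent_le_bernoulliExp {g : Finset α → ℝ} (hg : SetSubmodular g)
    {a b : α → ℝ} (ha : 0 ≤ a) (hab : a ≤ b) (hb : b ≤ 1) :
    bernoulliExp a g + ∑ e, (b e - a e) * gradient g e b ≤ bernoulliExp b g := by
  suffices h : ∀ T : Finset α, bernoulliExp a g + ∑ e ∈ T, (b e - a e) * gradient g e b ≤
      bernoulliExp (T.piecewise b a) g by simpa using h univ
  intro T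
  induction T using Finset.induction_on with
  | empty => simp
  | insert e T he ih =>
    rw [bernoulliExp_piecewise_insert a b g he, sum_insert he]
    have h := hg.gradient_antitone e (ha.trans (le_piecewise_of_le_of_le T hab le_rfl))
      (piecewise_le_of_le_of_le T le_rfl hab) hb
    linarith [mul_le_mul_of_nonneg_left h (sub_nonneg.2 (hab e))]

/-- Adding to the random set each `e` independently with probability `l e` leaves it unchanged
with probability at least `1 - ∑ l`. -/
lemma bernoulliExp_damping {y l : α → ℝ} (hy0 : 0 ≤ y) (hy1 : y ≤ 1) (hl0 : 0 ≤ l) (hl1 : l ≤ 1)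
    {g : Finset α → ℝ} (hg : ∀ U, 0 ≤ g U) :
    (1 - ∑ e, l e) * bernoulliExp y g ≤ bernoulliExp (fun e => y e + l e * (1 - y e)) g := by
  set b : α → ℝ := fun e => y e + l e * (1 - y e) with hb
  have hyb : y ≤ b := fun e => by
    have := mul_nonneg (hl0 e) (sub_nonneg.2 (hy1 e))
    simp only [hb, Pi.one_apply] at this ⊢; linarith
  have hb1 : b ≤ 1 := fun e => by
    have := mul_nonneg (sub_nonneg.2 (hl1 e)) (sub_nonneg.2 (hy1 e))
    simp only [hb, Pi.one_apply] at this ⊢; nlinarith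
  suffices h : ∀ T : Finset α,
      (1 - ∑ e ∈ T, l e) * bernoulliExp y g ≤ bernoulliExp (T.piecewise b y) g by
    simpa using h univ
  intro T
  induction T using Finset.induction_on with
  | empty => simp
  | insert e T he ih =>
    have h0 : 0 ≤ T.piecewise b y := hy0.trans (le_piecewise_of_le_of_le T hyb le_rfl)
    have h1 : T.piecewise b y ≤ 1 := (piecewise_le_of_le_of_le T le_rfl hyb).trans hb1
    rw [bernoulliExp_piecewise_insert y b g he, sum_insert he, gradient, bernoulliExp_sub]
    have hs := bernoulliExp_eq_insert_erase (T.piecewise b y) g e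
    rw [piecewise_eq_of_notMem _ _ _ he] at hs
    have hA := bernoulliExp_nonneg h0 h1 fun U => hg (insert e U)
    have hT : 0 ≤ ∑ e ∈ T, l e := sum_nonneg fun e _ => hl0 e
    have hy := bernoulliExp_nonneg hy0 hy1 hg
    have hstep : (1 - l e) * bernoulliExp (T.piecewise b y) g ≤
        bernoulliExp (T.piecewise b y) g + (b e - y e) *
          (bernoulliExp (T.piecewise b y) (fun U => g (insert e U)) -
            bernoulliExp (T.piecewise b y) (fun U => g (U.erase e))) := by
      rw [hs]; simp only [hb]
      nlinarith [mul_nonneg (hl0 e) hA]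
    refine le_trans ?_ hstep
    have h2 := mul_le_mul_of_nonneg_left ih (sub_nonneg.2 (hl1 e))
    have h3 := mul_nonneg (mul_nonneg (hl0 e) hT) hy
    simp only [Pi.one_apply] at h2
    linarith

lemma SetSubmodular.bernoulliExp_add_le {g : Finset α → ℝ} (hg : SetSubmodular g)
    (hg0 : ∀ U, 0 ≤ g U) {a b : α → ℝ} (ha : 0 ≤ a) (hb : 0 ≤ b) (hab : a + b ≤ 1) :
    bernoulliExp (a + b) g ≤ bernoulliExp a g + bernoulliExp b g := by
  suffices h : ∀ T : Finset α, bernoulliExp (T.piecewise (a + b) a) g - bernoulliExp a g ≤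
      bernoulliExp (T.piecewise b 0) g - bernoulliExp 0 g by
    have h' := h univ
    have h0 : 0 ≤ bernoulliExp 0 g :=
      bernoulliExp_nonneg (y := (0 : α → ℝ)) le_rfl zero_le_one hg0
    simp only [piecewise_univ] at h'
    linarith
  intro T
  induction T using Finset.induction_on with
  | empty => simp
  | insert e T he ih =>
    rw [bernoulliExp_piecewise_insert _ _ g he, bernoulliExp_piecewise_insert _ _ g he]
    have h := hg.gradient_antitone e (a := T.piecewise b 0) (b := T.piecewise (a + b) a)
      (le_piecewise_of_le_of_le T hb le_rfl)
      (fun j => by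
        by_cases hj : j ∈ T
        · simpa [hj] using ha j
        · simpa [hj] using ha j)
      ((piecewise_le_of_le_of_le T le_rfl (le_add_of_nonneg_right hb)).trans hab)
    have := mul_le_mul_of_nonneg_left h (hb e)
    simp only [Pi.add_apply, add_sub_cancel_left, Pi.zero_apply, sub_zero] at this ⊢
    linarith

/-- Concavity of the multilinear extension on the segment from `0` to `y`. -/
lemma SetSubmodular.bernoulliExp_le_four_mul {g : Finset α → ℝ} (hg : SetSubmodular g)
    (hg0 : ∀ U, 0 ≤ g U) {y : α → ℝ} (hy0 : 0 ≤ y) (hy1 : y ≤ 1) :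
    bernoulliExp y g ≤ 4 * bernoulliExp (fun e => y e / 4) g := by
  have hq0 : (0 : α → ℝ) ≤ fun e => y e / 4 := fun e => div_nonneg (hy0 e) (by norm_num)
  have hqy : (fun e => y e / 4) ≤ y := fun e => by
    have := hy0 e; simp only [Pi.zero_apply] at this; linarith
  have h1 := hg.bernoulliExp_le_tangent hq0 hqy hy1
  have h2 := hg.tangent_le_bernoulliExp le_rfl hq0 (hqy.trans hy1)
  have h0 : 0 ≤ bernoulliExp 0 g :=
    bernoulliExp_nonneg (y := (0 : α → ℝ)) le_rfl zero_le_one hg0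
  have h3 : ∑ e, (y e - y e / 4) * gradient g e (fun e => y e / 4) =
      3 * ∑ e, (y e / 4 - (0 : α → ℝ) e) * gradient g e (fun e => y e / 4) := by
    rw [mul_sum]; exact sum_congr rfl fun e _ => by simp only [Pi.zero_apply]; ring
  linarith

end Bernoulli

/-! ### The set function on item-state pairs -/

section SetFun

variable {I S : ℕ}

lemma vec_insert (i : Fin I) (s : Fin S) (U : Finset (Fin I × Fin S)) :
    vec (insert (i, s) U) = vec U ⊔ Pi.single i s.succ := by
  funext j
  by_cases hj : i = j
  · subst hj
    simp [vec, filter_insert, sup_comm]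
  · simp [vec, filter_insert, hj]

lemma vec_empty : vec (∅ : Finset (Fin I × Fin S)) = 0 := by
  funext j
  rfl

lemma vec_mono {U V : Finset (Fin I × Fin S)} (h : U ⊆ V) : vec U ≤ vec V := fun _ =>
  sup_mono (filter_subset_filter _ h)

lemma setFun_mono {f : (Fin I → Fin (S + 1)) → ℝ} (hf : Monotone f) : Monotone (setFun f) :=
  fun _ _ h => hf (vec_mono h)

lemma LatticeSubmodular.setSubmodular {f : (Fin I → Fin (S + 1)) → ℝ}
    (hf : LatticeSubmodular f) : SetSubmodular (setFun f) := by
  rintro U V hUV ⟨i, s⟩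
  simpa only [setFun, vec_insert] using hf _ _ (vec_mono hUV) i s.succ

lemma expect_eq_bernoulliExp (y : Fin I → Fin S → ℝ) (g : Finset (Fin I × Fin S) → ℝ) :
    expect y g = bernoulliExp (Function.uncurry y) g := rfl

lemma weight_le_gradient {f : (Fin I → Fin (S + 1)) → ℝ} (hf : Monotone f)
    {y : Fin I → Fin S → ℝ} (h0 : 0 ≤ Function.uncurry y) (h1 : Function.uncurry y ≤ 1)
    (i : Fin I) (s : Fin S) :
    weight f y i s ≤ gradient (setFun f) (i, s) (Function.uncurry y) := by
  rw [weight, expect_eq_bernoulliExp, expect_eq_bernoulliExp, ← bernoulliExp_sub]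
  exact bernoulliExp_mono h0 h1 fun U =>
    sub_le_sub_left (setFun_mono hf (erase_subset _ U)) _

end SetFun

/-! ### Expectation over the states -/

section StateExp

variable {I S : ℕ}

/-- Expectation of `A φ`, where the states `φ i` are independent with distributions `p i`. -/
noncomputable def stateExp (p : Fin I → Fin S → ℝ) (A : (Fin I → Fin S) → ℝ) : ℝ :=
  ∑ φ : Fin I → Fin S, (∏ i, p i (φ i)) * A φ

lemma stateExp_mono {p : Fin I → Fin S → ℝ} (hp : ∀ i s, 0 ≤ p i s)
    {A A' : (Fin I → Fin S) → ℝ} (h : ∀ φ, A φ ≤ A' φ) : stateExp p A ≤ stateExp p A' :=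
  sum_le_sum fun φ _ => mul_le_mul_of_nonneg_left (h φ) (prod_nonneg fun i _ => hp i _)

lemma stateExp_const {p : Fin I → Fin S → ℝ} (hp : ∀ i, ∑ s, p i s = 1) (C : ℝ) :
    stateExp p (fun _ => C) = C := by
  have h := Finset.prod_univ_sum (fun _ : Fin I => (univ : Finset (Fin S))) p
  simp only [hp, prod_const_one, Fintype.piFinset_univ] at h
  rw [stateExp, ← sum_mul, ← h, one_mul]

lemma stateExp_add (p : Fin I → Fin S → ℝ) (A A' : (Fin I → Fin S) → ℝ) :
    stateExp p (fun φ => A φ + A' φ) = stateExp p A + stateExp p A' := by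
  simp only [stateExp, mul_add, sum_add_distrib]

lemma stateExp_const_mul (p : Fin I → Fin S → ℝ) (C : ℝ) (A : (Fin I → Fin S) → ℝ) :
    stateExp p (fun φ => C * A φ) = C * stateExp p A := by
  simp only [stateExp, mul_sum]
  exact sum_congr rfl fun φ _ => by ring

lemma stateExp_sum {ι : Type*} (t : Finset ι) (p : Fin I → Fin S → ℝ)
    (A : ι → (Fin I → Fin S) → ℝ) :
    stateExp p (fun φ => ∑ j ∈ t, A j φ) = ∑ j ∈ t, stateExp p (A j) := by
  simp only [stateExp, mul_sum]
  exact sum_comm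

/-- Integrating out the state of item `i`, which is independent of the other states. -/
lemma stateExp_integrate_out {p : Fin I → Fin S → ℝ} (hp : ∀ i, ∑ s, p i s = 1) (i : Fin I)
    (A : Fin S → (Fin I → Fin S) → ℝ)
    (hA : ∀ s φ t, A s (Function.update φ i t) = A s φ) :
    stateExp p (fun φ => A (φ i) φ) = ∑ s, p i s * stateExp p (A s) := by
  have hl : stateExp p (fun φ => A (φ i) φ) =
      ∑ x : (Fin I → Fin S) × Fin S, p i x.2 * ((∏ j, p j (x.1 j)) * A (x.1 i) x.1) := by
    rw [Fintype.sum_prod_type]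
    simp only [← sum_mul, hp, one_mul, stateExp]
  have hr : ∑ s, p i s * stateExp p (A s) =
      ∑ x : (Fin I → Fin S) × Fin S, p i x.2 * ((∏ j, p j (x.1 j)) * A x.2 x.1) := by
    rw [Fintype.sum_prod_type_right]
    simp only [stateExp, mul_sum]
  rw [hl, hr]
  -- The state of `i` and an independent copy of it are exchangeable.
  refine sum_nbij' (fun x => (Function.update x.1 i x.2, x.1 i))
    (fun x => (Function.update x.1 i x.2, x.1 i)) (by simp) (by simp)
    (by simp) (by simp) ?_
  rintro ⟨φ, s⟩ -
  have hprod : ∏ j ∈ univ.erase i, p j (Function.update φ i s j) =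
      ∏ j ∈ univ.erase i, p j (φ j) :=
    prod_congr rfl fun j hj => by rw [Function.update_of_ne (ne_of_mem_erase hj)]
  simp only [hA]
  rw [← mul_prod_erase univ _ (mem_univ i), ← mul_prod_erase univ _ (mem_univ i), hprod,
    Function.update_self]
  ring

lemma stateExp_marginal {p : Fin I → Fin S → ℝ} (hp : ∀ i, ∑ s, p i s = 1) (i : Fin I)
    (s : Fin S) : stateExp p (fun φ => if φ i = s then 1 else 0) = p i s := by
  rw [stateExp_integrate_out hp i (fun t _ => if t = s then 1 else 0) fun _ _ _ => rfl]
  simp [stateExp_const hp]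

end StateExp

/-! ### Policies against the linear program -/

namespace Policy

variable {I S : ℕ}

lemma value_const (φ : Fin I → Fin S) (C : ℝ) (π : Policy I S) (G : Finset (Fin I × Fin S)) :
    value φ (fun _ => C) π G = C := by
  induction π generalizing G with
  | halt => rfl
  | coin q a b iha ihb => rw [value, iha, ihb]; ring
  | probe i q next ih => rw [value, ih, ih]; ring

lemma value_add (φ : Fin I → Fin S) (g g' : Finset (Fin I × Fin S) → ℝ) (π : Policy I S)
    (G : Finset (Fin I × Fin S)) :
    value φ (fun U => g U + g' U) π G = value φ g π G + value φ g' π G := by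
  induction π generalizing G with
  | halt => rfl
  | coin q a b iha ihb => simp only [value, iha, ihb]; ring
  | probe i q next ih => simp only [value, ih]; ring

lemma value_const_mul (φ : Fin I → Fin S) (C : ℝ) (g : Finset (Fin I × Fin S) → ℝ)
    (π : Policy I S) (G : Finset (Fin I × Fin S)) :
    value φ (fun U => C * g U) π G = C * value φ g π G := by
  induction π generalizing G with
  | halt => rfl
  | coin q a b iha ihb => simp only [value, iha, ihb]; ring
  | probe i q next ih => simp only [value, ih]; ring

lemma value_sum {ι : Type*} [DecidableEq ι] (t : Finset ι) (φ : Fin I → Fin S)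
    (g : ι → Finset (Fin I × Fin S) → ℝ) (π : Policy I S) (G : Finset (Fin I × Fin S)) :
    value φ (fun U => ∑ j ∈ t, g j U) π G = ∑ j ∈ t, value φ (g j) π G := by
  induction t using Finset.induction_on with
  | empty => simpa using value_const φ 0 π G
  | insert j t hj ih => simp only [sum_insert hj, value_add, ih]

lemma value_le_of_outcomes {φ : Fin I → Fin S} {g g' : Finset (Fin I × Fin S) → ℝ}
    {π : Policy I S} {G : Finset (Fin I × Fin S)} {A : Finset (Fin I)}
    (hπ : π.AdmissibleFrom A) (h : ∀ U ∈ outcomes φ π G, g U ≤ g' U) :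
    value φ g π G ≤ value φ g' π G := by
  induction π generalizing G A with
  | halt => exact h G rfl
  | coin q a b iha ihb =>
    obtain ⟨⟨h0, h1⟩, ha, hb⟩ := hπ
    refine add_le_add ?_ ?_
    · rcases eq_or_ne q 0 with hq | hq
      · simp [hq]
      · exact mul_le_mul_of_nonneg_left (iha ha fun U hU => h U (Or.inl ⟨hq, hU⟩)) h0
    · rcases eq_or_ne q 1 with hq | hq
      · simp [hq]
      · exact mul_le_mul_of_nonneg_left (ihb hb fun U hU => h U (Or.inr ⟨hq, hU⟩))
          (sub_nonneg.2 h1)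
  | probe i q next ih =>
    obtain ⟨-, hq, hn⟩ := hπ
    refine add_le_add ?_ ?_
    · rcases eq_or_ne (q (φ i)) 0 with hq' | hq'
      · simp [hq']
      · exact mul_le_mul_of_nonneg_left
          (ih _ _ (hn _ _) fun U hU => h U (Or.inl ⟨hq', hU⟩)) (hq _).1
    · rcases eq_or_ne (q (φ i)) 1 with hq' | hq'
      · simp [hq']
      · exact mul_le_mul_of_nonneg_left
          (ih _ _ (hn _ _) fun U hU => h U (Or.inr ⟨hq', hU⟩)) (sub_nonneg.2 (hq _).2)

lemma state_eq_of_mem_outcomes {φ : Fin I → Fin S} {π : Policy I S}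
    {G : Finset (Fin I × Fin S)} (hG : ∀ e ∈ G, φ e.1 = e.2) {U : Finset (Fin I × Fin S)}
    (hU : U ∈ outcomes φ π G) : ∀ e ∈ U, φ e.1 = e.2 := by
  induction π generalizing G with
  | halt => rwa [Set.mem_singleton_iff.1 hU]
  | coin q a b iha ihb =>
    rcases hU with ⟨-, h⟩ | ⟨-, h⟩
    · exact iha hG h
    · exact ihb hG h
  | probe i q next ih =>
    rcases hU with ⟨-, h⟩ | ⟨-, h⟩
    · refine ih _ _ (fun e he => ?_) h
      rcases mem_insert.1 he with rfl | he
      · rfl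
      · exact hG e he
    · exact ih _ _ hG h

/-- The probability that the policy `π` picks item `i` in state `s`. -/
noncomputable def pickProb (p : Fin I → Fin S → ℝ) (π : Policy I S) (i : Fin I) (s : Fin S) : ℝ :=
  stateExp p fun φ => value φ (fun U => if (i, s) ∈ U then 1 else 0) π ∅

lemma stateExp_value_sum (p : Fin I → Fin S → ℝ) (π : Policy I S) (w : Fin I → Fin S → ℝ) :
    stateExp p (fun φ => value φ (fun U => ∑ e ∈ U, w e.1 e.2) π ∅) =
      ∑ i, ∑ s, w i s * pickProb p π i s := by
  have h : ∀ U : Finset (Fin I × Fin S), ∑ e ∈ U, w e.1 e.2 =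
      ∑ e : Fin I × Fin S, w e.1 e.2 * if e ∈ U then 1 else 0 := fun U => by
    simp
  simp only [h, value_sum, value_const_mul, stateExp_sum, stateExp_const_mul,
    Fintype.sum_prod_type, pickProb]

/-- The probabilities with which a feasible policy picks the pairs satisfy the linear program. -/
lemma lpFeasible_pickProb {p c : Fin I → Fin S → ℝ} {B : ℝ} (hp0 : ∀ i s, 0 ≤ p i s)
    (hp1 : ∀ i, ∑ s, p i s = 1) {π : Policy I S} (hπ : π.Admissible) (hB : π.Feasible c B) :
    LPFeasible p c B (pickProb p π) := by
  refine ⟨fun i s => ⟨?_, ?_⟩, ?_⟩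
  · rw [← stateExp_const hp1 0]
    refine stateExp_mono hp0 fun φ => ?_
    refine (value_const φ 0 π ∅).symm.trans_le ?_
    exact value_le_of_outcomes hπ fun U _ => by split_ifs <;> norm_num
  · rw [← stateExp_marginal hp1 i s]
    refine stateExp_mono hp0 fun φ => ?_
    rw [← value_const φ (if φ i = s then 1 else 0) π ∅]
    refine value_le_of_outcomes hπ fun U hU => ?_
    by_cases h : (i, s) ∈ U
    · rw [if_pos h, if_pos (state_eq_of_mem_outcomes (by simp) hU _ h)]
    · rw [if_neg h]; split_ifs <;> norm_num
  · simp only [mul_comm _ (c _ _)]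
    rw [← stateExp_value_sum, ← stateExp_const hp1 B]
    refine stateExp_mono hp0 fun φ => ?_
    rw [← value_const φ B π ∅]
    exact value_le_of_outcomes hπ fun U hU => hB φ U hU

/-- A feasible policy is worth at most the multilinear extension at any `y` plus the optimum of
the linear program with the weights at `y`: the picks `G` of the policy are worth at most `G ∪ R`
for a random set `R` drawn independently of the policy, and submodularity bounds the gain of `G`
over `R` by the sum of the single gains. -/
lemma utility_le_of_lpOptimal {f : (Fin I → Fin (S + 1)) → ℝ} (hf_mono : Monotone f)
    (hf_sub : LatticeSubmodular f) {p c : Fin I → Fin S → ℝ} {B : ℝ} (hp0 : ∀ i s, 0 ≤ p i s)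
    (hp1 : ∀ i, ∑ s, p i s = 1) {y x : Fin I → Fin S → ℝ} (hy0 : 0 ≤ Function.uncurry y)
    (hy1 : Function.uncurry y ≤ 1) (hx : LPOptimal p c B (weight f y) x) {π : Policy I S}
    (hπ : π.Admissible) (hB : π.Feasible c B) :
    π.utility f p ≤ expect y (setFun f) + ∑ i, ∑ s, weight f y i s * x i s := by
  have hG : ∀ G, setFun f G ≤ expect y (setFun f) + ∑ e ∈ G, weight f y e.1 e.2 := by
    intro G
    simp only [weight, expect_eq_bernoulliExp]
    calc setFun f G = bernoulliExp (Function.uncurry y) fun _ => setFun f G :=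
          (bernoulliExp_const _ _).symm
      _ ≤ bernoulliExp (Function.uncurry y) fun U =>
            setFun f U + ∑ e ∈ G, (setFun f (insert e U) - setFun f U) :=
          bernoulliExp_mono hy0 hy1 fun U =>
            (setFun_mono hf_mono subset_union_left).trans (hf_sub.setSubmodular.union_le U G)
      _ = _ := by
          rw [bernoulliExp_add, bernoulliExp_sum]
          simp only [bernoulliExp_sub]
  calc π.utility f p = stateExp p fun φ => value φ (setFun f) π ∅ := rfl
    _ ≤ stateExp p fun φ => expect y (setFun f) +
          value φ (fun U => ∑ e ∈ U, weight f y e.1 e.2) π ∅ := by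
        refine stateExp_mono hp0 fun φ => ?_
        rw [← value_const φ (expect y (setFun f)) π ∅, ← value_add]
        exact value_le_of_outcomes hπ fun U _ => hG U
    _ = expect y (setFun f) + ∑ i, ∑ s, weight f y i s * pickProb p π i s := by
        rw [stateExp_add, stateExp_const hp1, stateExp_value_sum]
    _ ≤ _ := add_le_add le_rfl (hx.2 _ (lpFeasible_pickProb hp0 hp1 hπ hB))

end Policy

/-! ### Continuous greedy -/

section Greedy

/-- The value `4 F(y / 4)` gains at least the fraction `d (1 - ∑ l)` of the missing value in a step
of size `d` in direction `x`. Here `m` stands for the maximum of the earlier directions and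
`l = d (max m x - m) / 4`, so that `(y + d x) / 4` is dominated by `y` together with an
independent set with probabilities `l`. -/
lemma SetSubmodular.greedy_step {α : Type*} [Fintype α] [DecidableEq α] {g : Finset α → ℝ}
    (hg : SetSubmodular g) (hmono : Monotone g) (hg0 : ∀ U, 0 ≤ g U) {y x m : α → ℝ} {d v : ℝ}
    (hd : 0 ≤ d) (hm0 : ∀ e, 0 ≤ m e) (hx0 : ∀ e, 0 ≤ x e) (hmy : ∀ e, d * m e ≤ y e)
    (hy1 : ∀ e, y e + d * x e ≤ 1) (hl1 : ∑ e, d / 4 * (max (m e) (x e) - m e) ≤ 1)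
    (hv : v ≤ bernoulliExp y g + ∑ e, gradient g e y * x e) :
    d * (1 - ∑ e, d / 4 * (max (m e) (x e) - m e)) *
        (v - 4 * bernoulliExp (fun e => y e / 4) g) ≤
      4 * bernoulliExp (fun e => (y e + d * x e) / 4) g -
        4 * bernoulliExp (fun e => y e / 4) g := by
  set l : α → ℝ := fun e => d / 4 * (max (m e) (x e) - m e) with hl
  set b : α → ℝ := fun e => (y e + d * x e) / 4 with hb
  set a : α → ℝ := fun e => y e / 4 with ha
  have hdm : ∀ e, 0 ≤ d * m e := fun e => mul_nonneg hd (hm0 e)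
  have hdx : ∀ e, 0 ≤ d * x e := fun e => mul_nonneg hd (hx0 e)
  have hy0 : 0 ≤ y := fun e => (hdm e).trans (hmy e)
  have hyle : y ≤ 1 := fun e => by
    have := hy1 e; have := hdx e; simp only [Pi.one_apply]; linarith
  have ha0 : 0 ≤ a := fun e => div_nonneg (hy0 e) (by norm_num)
  have hab : a ≤ b := fun e => by have := hdx e; simp only [ha, hb]; linarith
  have hb1 : b ≤ 1 := fun e => by have := hy1 e; simp only [hb, Pi.one_apply]; linarith
  have hl0 : 0 ≤ l := fun e =>
    mul_nonneg (by linarith) (sub_nonneg.2 (le_max_left _ _))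
  have hlx : ∀ e, l e ≤ 1 / 4 ∧ b e ≤ y e + l e * (1 - y e) := fun e => by
    have h0 : 0 ≤ y e := hy0 e
    have h1 := hy1 e
    have h2 := hdx e
    have h3 := hmy e
    have h4 := hdm e
    simp only [hl, hb]
    rcases le_total (m e) (x e) with h | h
    · rw [max_eq_right h]
      constructor
      · linarith
      · nlinarith
    · rw [max_eq_left h]
      have := mul_le_mul_of_nonneg_left h hd
      constructor <;> linarith
  have hl1' : l ≤ 1 := fun e => (hlx e).1.trans (by norm_num)
  have hstep := hg.tangent_le_bernoulliExp ha0 hab hb1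
  have hgrad : ∀ e, (1 - ∑ e, l e) * gradient g e y ≤ gradient g e b := fun e => by
    refine (bernoulliExp_damping hy0 hyle hl0 hl1' fun U =>
      sub_nonneg.2 (hmono ((erase_subset e U).trans (subset_insert e U)))).trans ?_
    refine hg.gradient_antitone e (ha0.trans hab) (fun j => (hlx j).2) fun j => ?_
    have h1 := mul_nonneg (sub_nonneg.2 (hl1' j)) (sub_nonneg.2 (hyle j))
    simp only [Pi.one_apply] at h1 ⊢
    linarith
  have hsum : d / 4 * (1 - ∑ e, l e) * ∑ e, gradient g e y * x e ≤
      ∑ e, (b e - a e) * gradient g e b := by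
    rw [mul_sum]
    refine sum_le_sum fun e _ => ?_
    have h := mul_le_mul_of_nonneg_left (hgrad e) (hdx e)
    have : b e - a e = d * x e / 4 := by simp only [ha, hb]; ring
    rw [this]
    linarith
  have hF : bernoulliExp y g ≤ 4 * bernoulliExp a g := hg.bernoulliExp_le_four_mul hg0 hy0 hyle
  have hc : 0 ≤ d * (1 - ∑ e, l e) := mul_nonneg hd (sub_nonneg.2 hl1)
  have hvs : v - 4 * bernoulliExp a g ≤ ∑ e, gradient g e y * x e := by linarith
  linarith [mul_le_mul_of_nonneg_left hvs hc]

lemma one_sub_le_exp_quadratic {t : ℝ} (h0 : 0 ≤ t) (h1 : t ≤ 1) :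
    1 - t ≤ Real.exp (-t - t ^ 2 / 2) := by
  rcases h1.eq_or_lt with rfl | h1
  · simpa using (Real.exp_pos _).le
  have hs := Real.hasSum_pow_div_log_of_abs_lt_one (abs_lt.2 ⟨by linarith, h1⟩)
  have h := sum_le_hasSum (range 2) (fun n _ => by positivity) hs
  rw [← Real.log_le_iff_le_exp (by linarith)]
  norm_num [sum_range_succ] at h
  linarith

variable {I S : ℕ}

lemma exists_lpOptimal {p c : Fin I → Fin S → ℝ} {B : ℝ} (hp0 : ∀ i s, 0 ≤ p i s)
    (hB : 0 ≤ B) (w : Fin I → Fin S → ℝ) : ∃ x, LPOptimal p c B w x := by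
  have hset : {x | LPFeasible p c B x} =
      Set.Icc 0 p ∩ {x | ∑ i, ∑ s, x i s * c i s ≤ B} := by
    ext x
    simp only [LPFeasible, Set.mem_ofPred_eq, Set.mem_inter_iff, Set.mem_Icc, Pi.le_def,
      forall_and, Pi.zero_apply]
  have hK : IsCompact {x | LPFeasible p c B x} := by
    rw [hset]
    exact isCompact_Icc.inter_right (isClosed_le (by fun_prop) continuous_const)
  obtain ⟨x, hx, hmax⟩ := hK.exists_isMaxOn
    ⟨0, fun i s => ⟨le_rfl, hp0 i s⟩, by simpa using hB⟩
    (f := fun x => ∑ i, ∑ s, w i s * x i s) (by fun_prop)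
  exact ⟨x, hx, fun x' hx' => hmax hx'⟩

lemma exists_continuousGreedyOutput (f : (Fin I → Fin (S + 1)) → ℝ) {p c : Fin I → Fin S → ℝ}
    {B : ℝ} (hp0 : ∀ i s, 0 ≤ p i s) (hB : 0 ≤ B) : ∃ y, ContinuousGreedyOutput f p c B y := by
  choose X hX using fun w => exists_lpOptimal (c := c) hp0 hB w
  exact ⟨_, fun n => Nat.rec 0
    (fun _ y i s => y i s + 1 / ((I : ℝ) * (S : ℝ)) ^ 2 * X (weight f y) i s) n,
    fun _ _ => rfl, fun k _ => ⟨_, hX _, fun _ _ => rfl⟩, rfl⟩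

/-- The fractional point after `k` rounds is `k` steps deep in the linear program. -/
lemma greedy_iterate_feasible {p c : Fin I → Fin S → ℝ} {B d : ℝ} (hd : 0 ≤ d) {K : ℕ}
    {Y : ℕ → Fin I → Fin S → ℝ} (hY0 : ∀ i s, Y 0 i s = 0)
    (hY : ∀ k < K, ∃ x, LPFeasible p c B x ∧ ∀ i s, Y (k + 1) i s = Y k i s + d * x i s) :
    ∀ k ≤ K, (∀ i s, 0 ≤ Y k i s ∧ Y k i s ≤ k * d * p i s) ∧
      ∑ i, ∑ s, Y k i s * c i s ≤ k * d * B := by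
  intro k
  induction k with
  | zero => intro _; simp [hY0]
  | succ k ih =>
    intro hk
    obtain ⟨h1, h2⟩ := ih (by omega)
    obtain ⟨x, ⟨hx1, hx2⟩, hx⟩ := hY k (by omega)
    refine ⟨fun i s => ?_, ?_⟩
    · rw [hx]
      have := mul_nonneg hd (hx1 i s).1
      have := mul_le_mul_of_nonneg_left (hx1 i s).2 hd
      have := h1 i s
      push_cast
      constructor <;> linarith
    · have h3 : ∑ i, ∑ s, Y (k + 1) i s * c i s =
          ∑ i, ∑ s, Y k i s * c i s + d * ∑ i, ∑ s, x i s * c i s := by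
        simp only [hx, mul_sum, ← sum_add_distrib]
        exact sum_congr rfl fun i _ => sum_congr rfl fun s _ => by ring
      rw [h3]
      have := mul_le_mul_of_nonneg_left hx2 hd
      push_cast
      linarith

lemma ContinuousGreedyOutput.lpFeasible {f : (Fin I → Fin (S + 1)) → ℝ}
    {p c y : Fin I → Fin S → ℝ} {B : ℝ} (hp0 : ∀ i s, 0 ≤ p i s) (hB : 0 ≤ B)
    (hy : ContinuousGreedyOutput f p c B y) : LPFeasible p c B y := by
  obtain ⟨Y, hY0, hY, rfl⟩ := hy
  obtain ⟨h1, h2⟩ := greedy_iterate_feasible (d := 1 / ((I : ℝ) * (S : ℝ)) ^ 2) (by positivity) hY0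
    (fun k hk => (hY k hk).imp fun x hx => ⟨hx.1.1, hx.2⟩) _ le_rfl
  have hK : (((I * S) ^ 2 : ℕ) : ℝ) * (1 / ((I : ℝ) * (S : ℝ)) ^ 2) ≤ 1 := by
    push_cast
    rw [mul_one_div]
    exact div_self_le_one _
  refine ⟨fun i s => ⟨(h1 i s).1, (h1 i s).2.trans ?_⟩, h2.trans ?_⟩
  · exact mul_le_of_le_one_left (hp0 i s) hK
  · exact mul_le_of_le_one_left hB hK

/-- The guarantee of continuous greedy, for the value `4 F(y / 4)` and without loss from the
discretization. Each step of size `d` contracts the missing value by `1 - t` with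
`t = d (1 - d (M' - M) / 4)`, where `M` is the sum over all pairs of the largest coordinate so far
of a linear program solution. The terms `M' - M` telescope to at most `I`, and
`1 - t ≤ exp (- t - t ^ 2 / 2)` compensates for them. -/
lemma ContinuousGreedyOutput.value_ge {f : (Fin I → Fin (S + 1)) → ℝ} (hf0 : ∀ u, 0 ≤ f u)
    (hf_mono : Monotone f) (hf_sub : LatticeSubmodular f) {p c y : Fin I → Fin S → ℝ} {B v : ℝ}
    (hp0 : ∀ i s, 0 ≤ p i s) (hp1 : ∀ i, ∑ s, p i s = 1) (hI : 0 < I)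
    (hv0 : 0 ≤ v)
    (hv : ∀ y x : Fin I → Fin S → ℝ, 0 ≤ Function.uncurry y → Function.uncurry y ≤ 1 →
      LPOptimal p c B (weight f y) x →
        v ≤ expect y (setFun f) + ∑ i, ∑ s, weight f y i s * x i s)
    (hy : ContinuousGreedyOutput f p c B y) :
    (1 - 1 / Real.exp 1) * v ≤
      4 * bernoulliExp (fun e => Function.uncurry y e / 4) (setFun f) := by
  have hS : 0 < S := by
    rcases Nat.eq_zero_or_pos S with rfl | h
    · simpa using hp1 ⟨0, hI⟩
    · exact h
  have hple : ∀ i s, p i s ≤ 1 := fun i s =>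
    hp1 i ▸ single_le_sum (f := p i) (fun s _ => hp0 i s) (mem_univ s)
  obtain ⟨Y, hY0, hY, rfl⟩ := hy
  set d : ℝ := 1 / ((I : ℝ) * (S : ℝ)) ^ 2 with hd
  set K : ℕ := (I * S) ^ 2 with hK
  have hI1 : (1 : ℝ) ≤ I := by exact_mod_cast hI
  have hS1 : (1 : ℝ) ≤ S := by exact_mod_cast hS
  have hd0 : 0 < d := by positivity
  have hKd : (K : ℝ) * d = 1 := by
    rw [hK, hd]; push_cast; field_simp
  have hIK : (I : ℝ) ≤ K := by
    have h1 : I ≤ I * S := Nat.le_mul_of_pos_right I hS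
    have h2 : I * S ≤ (I * S) ^ 2 := Nat.le_self_pow two_ne_zero _
    exact_mod_cast h1.trans h2
  have hdI : d * I ≤ 1 := by
    rw [← hKd, mul_comm (K : ℝ)]; exact mul_le_mul_of_nonneg_left hIK hd0.le
  have hd1 : d ≤ 1 := (le_mul_of_one_le_right hd0.le hI1).trans hdI
  have hfeas := greedy_iterate_feasible hd0.le hY0
    (fun k hk => (hY k hk).imp fun x hx => ⟨hx.1.1, hx.2⟩)
  have hYle : ∀ k ≤ K, ∀ i s, Y k i s ≤ 1 := fun k hk i s => by
    refine (((hfeas k hk).1 i s).2.trans ?_).trans (hple i s)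
    refine mul_le_of_le_one_left (hp0 i s) (hKd ▸ ?_)
    exact mul_le_mul_of_nonneg_right (by exact_mod_cast hk) hd0.le
  set Φ : ℕ → ℝ := fun k =>
    4 * bernoulliExp (fun e => Function.uncurry (Y k) e / 4) (setFun f) with hΦ
  have hsumle : ∀ m : Fin I × Fin S → ℝ, (∀ e, m e ≤ p e.1 e.2) → ∑ e, m e ≤ I := fun m hm => by
    refine (sum_le_sum fun e _ => hm e).trans ?_
    rw [Fintype.sum_prod_type]
    simp [hp1]
  have key : ∀ k ≤ K, ∃ m : Fin I × Fin S → ℝ, (∀ e, 0 ≤ m e) ∧ (∀ e, m e ≤ p e.1 e.2) ∧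
      (∀ e, d * m e ≤ Function.uncurry (Y k) e) ∧
      v - Φ k ≤ v * Real.exp (-(k * d) - k * d ^ 2 / 2 + (1 + d) * (d ^ 2 / 4) * ∑ e, m e) := by
    intro k
    induction k with
    | zero =>
      intro _
      refine ⟨0, fun _ => le_rfl, fun e => hp0 _ _, fun e => by
        simp [Function.uncurry, hY0], ?_⟩
      have : 0 ≤ Φ 0 := mul_nonneg (by norm_num) <| bernoulliExp_nonneg
        (fun e => by simp [Function.uncurry, hY0]) (fun e => by simp [Function.uncurry, hY0])
        fun U => hf0 _
      simpa using this
    | succ k ih =>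
      intro hk
      obtain ⟨m, hm0, hmp, hmY, hmv⟩ := ih (by omega)
      obtain ⟨x, hx, hxY⟩ := hY k (by omega)
      have hx0 : ∀ e, 0 ≤ Function.uncurry x e := fun e => (hx.1.1 e.1 e.2).1
      have hxp : ∀ e, Function.uncurry x e ≤ p e.1 e.2 := fun e => (hx.1.1 e.1 e.2).2
      have hY' : ∀ e, Function.uncurry (Y (k + 1)) e =
          Function.uncurry (Y k) e + d * Function.uncurry x e := fun e => hxY e.1 e.2
      have hYk0 : 0 ≤ Function.uncurry (Y k) := fun e => ((hfeas k (by omega)).1 e.1 e.2).1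
      have hYk1 : Function.uncurry (Y k) ≤ 1 := fun e => hYle k (by omega) e.1 e.2
      set m' : Fin I × Fin S → ℝ := fun e => max (m e) (Function.uncurry x e) with hm'
      have hm'p : ∀ e, m' e ≤ p e.1 e.2 := fun e => max_le (hmp e) (hxp e)
      have hmm' : ∑ e, m e ≤ ∑ e, m' e := sum_le_sum fun e _ => le_max_left _ _
      have hL : ∑ e, d / 4 * (max (m e) (Function.uncurry x e) - m e) =
          d / 4 * (∑ e, m' e - ∑ e, m e) := by
        rw [← mul_sum, sum_sub_distrib]
      have hM0 : 0 ≤ ∑ e, m e := sum_nonneg fun e _ => hm0 e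
      have hL1 : d / 4 * (∑ e, m' e - ∑ e, m e) ≤ 1 := by
        have := mul_le_mul_of_nonneg_left (hsumle m' hm'p) hd0.le
        nlinarith
      have hL0 : 0 ≤ d / 4 * (∑ e, m' e - ∑ e, m e) :=
        mul_nonneg (by linarith) (sub_nonneg.2 hmm')
      have hstep := hf_sub.setSubmodular.greedy_step (setFun_mono hf_mono) (fun U => hf0 _)
        hd0.le hm0 hx0 hmY (fun e => hY' e ▸ hYle (k + 1) hk e.1 e.2) (hL ▸ hL1)
        (v := v) <| by
          refine (hv _ _ hYk0 hYk1 hx).trans (add_le_add le_rfl ?_)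
          rw [Fintype.sum_prod_type]
          exact sum_le_sum fun i _ => sum_le_sum fun s _ =>
            mul_le_mul_of_nonneg_right (weight_le_gradient hf_mono hYk0 hYk1 i s) (hx0 (i, s))
      rw [hL] at hstep
      simp only [← hY'] at hstep
      set L := d / 4 * (∑ e, m' e - ∑ e, m e) with hLdef
      refine ⟨m', fun e => (hm0 e).trans (le_max_left _ _), hm'p, fun e => ?_, ?_⟩
      · rw [hY', hm', mul_max_of_nonneg _ _ hd0.le]
        exact max_le ((hmY e).trans (le_add_of_nonneg_right (mul_nonneg hd0.le (hx0 e))))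
          (le_add_of_nonneg_left (hYk0 e))
      · have ht0 : 0 ≤ d * (1 - L) := mul_nonneg hd0.le (sub_nonneg.2 hL1)
        have ht1 : d * (1 - L) ≤ 1 := by nlinarith
        calc v - Φ (k + 1) ≤ (1 - d * (1 - L)) * (v - Φ k) := by
              simp only [hΦ]; linarith
          _ ≤ (1 - d * (1 - L)) * (v * Real.exp (-(k * d) - k * d ^ 2 / 2 +
                (1 + d) * (d ^ 2 / 4) * ∑ e, m e)) :=
              mul_le_mul_of_nonneg_left hmv (sub_nonneg.2 ht1)
          _ ≤ Real.exp (-(d * (1 - L)) - (d * (1 - L)) ^ 2 / 2) *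
                (v * Real.exp (-(k * d) - k * d ^ 2 / 2 +
                  (1 + d) * (d ^ 2 / 4) * ∑ e, m e)) :=
              mul_le_mul_of_nonneg_right (one_sub_le_exp_quadratic ht0 ht1)
                (mul_nonneg hv0 (Real.exp_pos _).le)
          _ = v * Real.exp (-(d * (1 - L)) - (d * (1 - L)) ^ 2 / 2 +
                (-(k * d) - k * d ^ 2 / 2 + (1 + d) * (d ^ 2 / 4) * ∑ e, m e)) := by
              rw [Real.exp_add (-(d * (1 - L)) - (d * (1 - L)) ^ 2 / 2)]; ring
          _ ≤ _ := by
              refine mul_le_mul_of_nonneg_left (Real.exp_le_exp.2 ?_) hv0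
              have hM : (1 + d) * (d ^ 2 / 4) * ∑ e, m' e =
                  (1 + d) * (d ^ 2 / 4) * ∑ e, m e + (1 + d) * d * L := by
                rw [hLdef]; ring
              rw [hM]
              push_cast
              nlinarith [mul_nonneg (sq_nonneg d) (sq_nonneg L)]
  obtain ⟨m, hm0, hmp, -, hm⟩ := key K le_rfl
  have hdM : d * ∑ e, m e ≤ 1 :=
    (mul_le_mul_of_nonneg_left (hsumle m hmp) hd0.le).trans hdI
  have hexp : -(K * d) - K * d ^ 2 / 2 + (1 + d) * (d ^ 2 / 4) * ∑ e, m e ≤ -1 := by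
    have h1 : (K : ℝ) * d ^ 2 = d := by rw [pow_two, ← mul_assoc, hKd, one_mul]
    have h2 := mul_le_mul_of_nonneg_left hdM (mul_nonneg (by linarith : 0 ≤ 1 + d) hd0.le)
    rw [h1, hKd]
    nlinarith
  have h := hm.trans (mul_le_mul_of_nonneg_left (Real.exp_le_exp.2 hexp) hv0)
  rw [Real.exp_neg, ← one_div] at h
  simp only [hΦ] at h
  linarith

end Greedy

/-! ### Sampling at most one state per item -/

section Exclusive

variable {I S : ℕ}

/-- Expectation of `f` at the join of `u` with a random vector that is supported on the listed
items: item `i` is in state `s` with probability `z i s` and absent otherwise, independently over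
the items. -/
noncomputable def exclusiveExp (f : (Fin I → Fin (S + 1)) → ℝ) (z : Fin I → Fin S → ℝ) :
    List (Fin I) → (Fin I → Fin (S + 1)) → ℝ
  | [], u => f u
  | i :: l, u => ∑ s, z i s * exclusiveExp f z l (u ⊔ Pi.single i s.succ) +
      (1 - ∑ s, z i s) * exclusiveExp f z l u

lemma le_exclusiveExp {f : (Fin I → Fin (S + 1)) → ℝ} (hf : Monotone f) {z : Fin I → Fin S → ℝ}
    (hz0 : ∀ i s, 0 ≤ z i s) (hz1 : ∀ i, ∑ s, z i s ≤ 1) (l : List (Fin I))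
    (u : Fin I → Fin (S + 1)) : f u ≤ exclusiveExp f z l u := by
  induction l generalizing u with
  | nil => exact le_rfl
  | cons i l ih =>
    rw [exclusiveExp]
    calc f u = ∑ s, z i s * f u + (1 - ∑ s, z i s) * f u := by rw [← sum_mul]; ring
      _ ≤ _ := add_le_add
        (sum_le_sum fun s _ =>
          mul_le_mul_of_nonneg_left ((hf le_sup_left).trans (ih _)) (hz0 i s))
        (mul_le_mul_of_nonneg_left (ih u) (sub_nonneg.2 (hz1 i)))

lemma exclusiveExp_gain_antitone {f : (Fin I → Fin (S + 1)) → ℝ} (hf : LatticeSubmodular f)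
    {z : Fin I → Fin S → ℝ} (hz0 : ∀ i s, 0 ≤ z i s) (hz1 : ∀ i, ∑ s, z i s ≤ 1)
    (l : List (Fin I)) : Antitone fun u => exclusiveExp f z l u - f u := by
  induction l with
  | nil => intro u v _; simp [exclusiveExp]
  | cons i l ih =>
    intro u v huv
    have hgain : ∀ u : Fin I → Fin (S + 1), exclusiveExp f z (i :: l) u - f u =
        ∑ s, z i s * (exclusiveExp f z l (u ⊔ Pi.single i s.succ) - f (u ⊔ Pi.single i s.succ)
          + (f (u ⊔ Pi.single i s.succ) - f u)) +
        (1 - ∑ s, z i s) * (exclusiveExp f z l u - f u) := fun u => by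
      simp only [exclusiveExp, sub_add_sub_cancel, mul_sub, sum_sub_distrib, ← sum_mul]
      ring
    simp only [hgain]
    refine add_le_add (sum_le_sum fun s _ => mul_le_mul_of_nonneg_left ?_ (hz0 i s))
      (mul_le_mul_of_nonneg_left (ih huv) (sub_nonneg.2 (hz1 i)))
    exact add_le_add (ih (sup_le_sup_right huv _)) (hf u v huv i s.succ)

lemma bernoulliExp_zero {α : Type*} [Fintype α] [DecidableEq α] (g : Finset α → ℝ) :
    bernoulliExp 0 g = g ∅ := by
  rw [bernoulliExp, sum_eq_single ∅]
  · simp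
  · intro U _ hU
    obtain ⟨e, he⟩ := nonempty_iff_ne_empty.2 hU
    rw [prod_eq_zero he rfl]
    ring
  · simp

/-- Exclusive sampling of the states of an item is worth at least independent sampling with the
same marginals: the states of an item form a chain, so that the gain of a set of states is at most
the sum of the single gains. -/
lemma bernoulliExp_le_exclusiveExp {f : (Fin I → Fin (S + 1)) → ℝ}
    (hf_sub : LatticeSubmodular f) {z : Fin I → Fin S → ℝ} (hz0 : ∀ i s, 0 ≤ z i s)
    (hz1 : ∀ i, ∑ s, z i s ≤ 1) {l : List (Fin I)} (hl : l.Nodup) (u : Fin I → Fin (S + 1)) :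
    bernoulliExp (fun e : Fin I × Fin S => if e.1 ∈ l then z e.1 e.2 else 0)
      (fun U => f (u ⊔ vec U)) ≤ exclusiveExp f z l u := by
  induction l generalizing u with
  | nil =>
    have h : (fun e : Fin I × Fin S => if e.1 ∈ ([] : List (Fin I)) then z e.1 e.2 else 0) = 0 := by
      funext e; simp
    rw [h, bernoulliExp_zero, vec_empty]
    have h0 : (0 : Fin I → Fin (S + 1)) ≤ u := fun j => Fin.zero_le _
    rw [sup_eq_left.2 h0, exclusiveExp]
  | cons i l ih =>
    obtain ⟨hi, hl⟩ := List.nodup_cons.1 hl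
    have hsub : SetSubmodular fun U : Finset (Fin I × Fin S) => f (u ⊔ vec U) := by
      rintro U V hUV ⟨j, s⟩
      simpa only [vec_insert, ← sup_assoc] using
        hf_sub _ _ (sup_le_sup_left (vec_mono hUV) u) j s.succ
    have hle : ∀ i s, z i s ≤ 1 := fun i s =>
      (single_le_sum (f := z i) (fun s _ => hz0 i s) (mem_univ s)).trans (hz1 i)
    set a : Fin I × Fin S → ℝ := fun e => if e.1 ∈ l then z e.1 e.2 else 0 with ha
    set b : Fin I × Fin S → ℝ := fun e => if e.1 ∈ i :: l then z e.1 e.2 else 0 with hb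
    have hba : ∀ e, b e - a e = if e.1 = i then z e.1 e.2 else 0 := fun e => by
      by_cases h1 : e.1 = i
      · simp [ha, hb, h1, hi]
      · simp [ha, hb, h1]
    have ha0 : 0 ≤ a := fun e => by
      simp only [ha, Pi.zero_apply]; split_ifs; exacts [hz0 _ _, le_rfl]
    have hab : a ≤ b := fun e => by
      rw [← sub_nonneg, hba]; split_ifs; exacts [hz0 _ _, le_rfl]
    have hb1 : b ≤ 1 := fun e => by
      simp only [hb, Pi.one_apply]; split_ifs; exacts [hle _ _, zero_le_one]
    have hgrad : ∀ s, gradient (fun U => f (u ⊔ vec U)) (i, s) a =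
        bernoulliExp a (fun U => f (u ⊔ Pi.single i s.succ ⊔ vec U)) -
          bernoulliExp a (fun U => f (u ⊔ vec U)) := fun s => by
      have hae : a (i, s) = 0 := by simp [ha, hi]
      rw [gradient, bernoulliExp_sub,
        bernoulliExp_erase_of_eq_zero (fun U => f (u ⊔ vec U)) hae]
      simp only [vec_insert, sup_left_comm, sup_comm]
    refine (hsub.bernoulliExp_le_tangent ha0 hab hb1).trans ?_
    simp only [hba, Fintype.sum_prod_type, ite_mul, zero_mul]
    rw [sum_comm]
    simp only [sum_ite_eq', mem_univ, if_true, hgrad, mul_sub, sum_sub_distrib, ← sum_mul]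
    rw [exclusiveExp]
    have h1 : ∑ s, z i s * bernoulliExp a (fun U => f (u ⊔ Pi.single i s.succ ⊔ vec U)) ≤
        ∑ s, z i s * exclusiveExp f z l (u ⊔ Pi.single i s.succ) :=
      sum_le_sum fun s _ => mul_le_mul_of_nonneg_left (ih hl _) (hz0 i s)
    have h2 := mul_le_mul_of_nonneg_left (ih hl u) (sub_nonneg.2 (hz1 i))
    linarith

end Exclusive

/-! ### Scanning the items within the budget -/

section Scan

variable {I S : ℕ}

/-- Chebyshev's sum inequality for a random variable with values `none` (probability
`1 - ∑ z`, cost `0`, value `D₀`) and `s` (probability `z s`, cost `k s`, value `D s`), whose values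
decrease as the costs increase. -/
lemma chebyshev_cost_value {z k D : Fin S → ℝ} {D₀ : ℝ} (hz0 : ∀ s, 0 ≤ z s)
    (hz1 : ∑ s, z s ≤ 1) (hk0 : ∀ s, 0 ≤ k s) (hk : Monotone k) (hD : Antitone D)
    (hD0 : ∀ s, D s ≤ D₀) :
    ∑ s, z s * k s * D s ≤
      (∑ s, z s * k s) * (∑ s, z s * D s + (1 - ∑ s, z s) * D₀) := by
  have h1 : 0 ≤ ∑ s, ∑ t, z s * z t * ((k t - k s) * (D s - D t)) :=
    sum_nonneg fun s _ => sum_nonneg fun t _ => mul_nonneg (mul_nonneg (hz0 s) (hz0 t)) <| by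
      rcases le_total s t with h | h
      · exact mul_nonneg (sub_nonneg.2 (hk h)) (sub_nonneg.2 (hD h))
      · exact mul_nonneg_of_nonpos_of_nonpos (sub_nonpos.2 (hk h)) (sub_nonpos.2 (hD h))
  have h2 : ∑ s, ∑ t, z s * z t * ((k t - k s) * (D s - D t)) =
      2 * ((∑ s, z s * k s) * (∑ s, z s * D s) - (∑ s, z s) * ∑ s, z s * k s * D s) := by
    have h : ∀ s t, z s * z t * ((k t - k s) * (D s - D t)) =
        (z s * D s) * (z t * k t) - z s * (z t * k t * D t) - (z s * k s * D s) * z t +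
          (z s * k s) * (z t * D t) := fun s t => by ring
    simp only [h, sum_add_distrib, sum_sub_distrib, ← sum_mul_sum]
    ring
  have h3 : 0 ≤ D₀ * ∑ s, z s * k s - ∑ s, z s * k s * D s := by
    rw [mul_sum, ← sum_sub_distrib]
    refine sum_nonneg fun s _ => ?_
    nlinarith [mul_nonneg (mul_nonneg (hz0 s) (hk0 s)) (sub_nonneg.2 (hD0 s))]
  nlinarith [mul_nonneg (sub_nonneg.2 hz1) h3]

lemma Policy.subset_of_mem_outcomes {φ : Fin I → Fin S} {π : Policy I S}
    {G U : Finset (Fin I × Fin S)} (hU : U ∈ outcomes φ π G) : G ⊆ U := by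
  induction π generalizing G with
  | halt => rw [Set.mem_singleton_iff.1 hU]
  | coin q a b iha ihb =>
    rcases hU with ⟨-, h⟩ | ⟨-, h⟩
    · exact iha h
    · exact ihb h
  | probe i q next ih =>
    rcases hU with ⟨-, h⟩ | ⟨-, h⟩
    · exact (subset_insert _ _).trans (ih _ _ h)
    · exact ih _ _ h

lemma scan_value_update (p c y : Fin I → Fin S → ℝ) (keep : Fin I → Fin S → Prop)
    (g : Finset (Fin I × Fin S) → ℝ) {l : List (Fin I)} {i : Fin I} (hi : i ∉ l) (t : Fin S)
    (φ : Fin I → Fin S) (b : ℝ) (G : Finset (Fin I × Fin S)) :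
    Policy.value (Function.update φ i t) g (scan p c y keep l b) G =
      Policy.value φ g (scan p c y keep l b) G := by
  induction l generalizing b G with
  | nil => rfl
  | cons j l ih =>
    obtain ⟨hij, hi⟩ := not_or.1 (mt List.mem_cons.2 hi)
    have hj : Function.update φ i t j = φ j := Function.update_of_ne (Ne.symm hij) _ _
    simp only [scan, Policy.value]
    rw [hj, ih hi, ih hi]

lemma scan_admissibleFrom {p c y : Fin I → Fin S → ℝ} (keep : Fin I → Fin S → Prop)
    (hy0 : ∀ i s, 0 ≤ y i s) (hyp : ∀ i s, y i s ≤ p i s) {l : List (Fin I)} (hl : l.Nodup)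
    (b : ℝ) {A : Finset (Fin I)} (hA : ∀ i ∈ l, i ∉ A) :
    (scan p c y keep l b).AdmissibleFrom A := by
  induction l generalizing b A with
  | nil => trivial
  | cons i l ih =>
    obtain ⟨hi, hl⟩ := List.nodup_cons.1 hl
    refine ⟨hA i (by simp), fun s => ?_, fun s d => ih hl _ fun j hj => ?_⟩
    · have hp0 := (hy0 i s).trans (hyp i s)
      dsimp only
      split_ifs
      · exact ⟨div_nonneg (hy0 i s) (by linarith),
          div_le_one_of_le₀ (by linarith [hyp i s]) (by linarith)⟩
      · exact ⟨le_rfl, zero_le_one⟩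
    · rw [mem_insert, not_or]
      exact ⟨ne_of_mem_of_not_mem hj hi, hA j (by simp [hj])⟩

lemma scan_cost_le {p c y : Fin I → Fin S → ℝ} (keep : Fin I → Fin S → Prop)
    (hc0 : ∀ i s, 0 ≤ c i s) {l : List (Fin I)} {b : ℝ} (hb : 0 ≤ b) {φ : Fin I → Fin S}
    {G U : Finset (Fin I × Fin S)} (hU : U ∈ Policy.outcomes φ (scan p c y keep l b) G) :
    ∑ e ∈ U, c e.1 e.2 ≤ ∑ e ∈ G, c e.1 e.2 + b := by
  induction l generalizing b G with
  | nil =>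
    rw [Set.mem_singleton_iff.1 hU]
    linarith
  | cons i l ih =>
    rcases hU with ⟨hq, h⟩ | ⟨-, h⟩
    · have hcb : c i (φ i) ≤ b := by
        by_contra hcon
        exact hq (if_neg fun h => hcon h.2)
      refine (ih (by simpa using hcb) h).trans ?_
      have hins : ∑ e ∈ insert (i, φ i) G, c e.1 e.2 ≤ c i (φ i) + ∑ e ∈ G, c e.1 e.2 := by
        by_cases he : (i, φ i) ∈ G
        · rw [insert_eq_of_mem he]; linarith [hc0 i (φ i)]
        · rw [sum_insert he]
      rw [if_pos rfl]
      linarith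
    · exact ih hb h

/-- Expected utility of `scan` when the pairs in `G` have been picked already. -/
noncomputable def scanUtility (f : (Fin I → Fin (S + 1)) → ℝ) (p c y : Fin I → Fin S → ℝ)
    (keep : Fin I → Fin S → Prop) (l : List (Fin I)) (b : ℝ) (G : Finset (Fin I × Fin S)) : ℝ :=
  stateExp p fun φ => Policy.value φ (setFun f) (scan p c y keep l b) G

lemma le_scanUtility {f : (Fin I → Fin (S + 1)) → ℝ} (hf : Monotone f)
    {p c y : Fin I → Fin S → ℝ} (keep : Fin I → Fin S → Prop) (hp1 : ∀ i, ∑ s, p i s = 1)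
    (hy0 : ∀ i s, 0 ≤ y i s) (hyp : ∀ i s, y i s ≤ p i s) {l : List (Fin I)} (hl : l.Nodup)
    (b : ℝ) (G : Finset (Fin I × Fin S)) : f (vec G) ≤ scanUtility f p c y keep l b G := by
  rw [← stateExp_const hp1 (f (vec G))]
  refine stateExp_mono (fun i s => (hy0 i s).trans (hyp i s)) fun φ => ?_
  rw [← Policy.value_const φ (f (vec G)) (scan p c y keep l b) G]
  exact Policy.value_le_of_outcomes (scan_admissibleFrom keep hy0 hyp hl b (A := ∅) (by simp))
    fun U hU => setFun_mono hf (Policy.subset_of_mem_outcomes hU)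

open Classical in
lemma scanUtility_cons {f : (Fin I → Fin (S + 1)) → ℝ} {p c y : Fin I → Fin S → ℝ}
    (keep : Fin I → Fin S → Prop) (hp1 : ∀ i, ∑ s, p i s = 1)
    (hy0 : ∀ i s, 0 ≤ y i s) (hyp : ∀ i s, y i s ≤ p i s) {i : Fin I} {l : List (Fin I)}
    (hi : i ∉ l) (b : ℝ) (G : Finset (Fin I × Fin S)) :
    scanUtility f p c y keep (i :: l) b G =
      ∑ s, (if keep i s ∧ c i s ≤ b then y i s / 4 else 0) *
          scanUtility f p c y keep l (b - c i s) (insert (i, s) G) +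
        (1 - ∑ s, if keep i s ∧ c i s ≤ b then y i s / 4 else 0) *
          scanUtility f p c y keep l b G := by
  have hpq : ∀ s, p i s * (if keep i s ∧ c i s ≤ b then y i s / (4 * p i s) else 0) =
      if keep i s ∧ c i s ≤ b then y i s / 4 else 0 := fun s => by
    split_ifs
    · -- The quotient is junk if `p i s = 0`, but then `y i s = 0` as well.
      rcases eq_or_ne (p i s) 0 with h | h
      · have : y i s = 0 := le_antisymm (h ▸ hyp i s) (hy0 i s)
        simp [this]
      · field_simp
    · simp
  have hscan : scanUtility f p c y keep (i :: l) b G = ∑ s, p i s *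
      ((if keep i s ∧ c i s ≤ b then y i s / (4 * p i s) else 0) *
          scanUtility f p c y keep l (b - c i s) (insert (i, s) G) +
        (1 - if keep i s ∧ c i s ≤ b then y i s / (4 * p i s) else 0) *
          scanUtility f p c y keep l b G) := by
    refine (stateExp_integrate_out hp1 i (fun s φ =>
      (if keep i s ∧ c i s ≤ b then y i s / (4 * p i s) else 0) *
          Policy.value φ (setFun f) (scan p c y keep l (b - c i s)) (insert (i, s) G) +
        (1 - if keep i s ∧ c i s ≤ b then y i s / (4 * p i s) else 0) *
          Policy.value φ (setFun f) (scan p c y keep l b) G) fun s φ t => ?_).trans ?_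
    · simp only [scan_value_update p c y keep _ hi]
    · simp only [scanUtility, stateExp_add, stateExp_const_mul]
  rw [hscan, sub_mul, one_mul]
  have h : ∀ s, p i s *
      ((if keep i s ∧ c i s ≤ b then y i s / (4 * p i s) else 0) *
          scanUtility f p c y keep l (b - c i s) (insert (i, s) G) +
        (1 - if keep i s ∧ c i s ≤ b then y i s / (4 * p i s) else 0) *
          scanUtility f p c y keep l b G) =
      (if keep i s ∧ c i s ≤ b then y i s / 4 else 0) *
          scanUtility f p c y keep l (b - c i s) (insert (i, s) G) +
        (p i s * scanUtility f p c y keep l b G -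
          (if keep i s ∧ c i s ≤ b then y i s / 4 else 0) *
            scanUtility f p c y keep l b G) := fun s => by
    rw [← hpq s]; ring
  simp only [h, sum_add_distrib, sum_sub_distrib, ← sum_mul, hp1, one_mul]

/-- The utility of `scan` against exclusive sampling without a budget. Here `t` is the load of the
pairs picked so far, measured by `k`, and `Inv b t` relates it to the remaining budget `b`: every
kept pair is affordable while the load is below `1`. The factor
`1 - t - ∑ z k` is Markov's lower bound for the probability that the load stays below `1`; it may
be multiplied with the expected gain because both the gain and the negated load decrease in the
state of each item. -/
lemma scanUtility_ge {f : (Fin I → Fin (S + 1)) → ℝ} (hf_mono : Monotone f)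
    (hf_sub : LatticeSubmodular f) {p c y z k : Fin I → Fin S → ℝ} {keep : Fin I → Fin S → Prop}
    (hp1 : ∀ i, ∑ s, p i s = 1) (hy0 : ∀ i s, 0 ≤ y i s) (hyp : ∀ i s, y i s ≤ p i s)
    (hz_keep : ∀ i s, keep i s → z i s = y i s / 4) (hz_discard : ∀ i s, ¬ keep i s → z i s = 0)
    (hk0 : ∀ i s, 0 ≤ k i s) (hk : ∀ i, Monotone (k i)) {Inv : ℝ → ℝ → Prop}
    (hInv_afford : ∀ b t, Inv b t → t < 1 → ∀ i s, keep i s → 0 < p i s → c i s ≤ b)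
    (hInv_pick : ∀ b t, Inv b t → ∀ i s, keep i s → c i s ≤ b → Inv (b - c i s) (t + k i s))
    {l : List (Fin I)} (hl : l.Nodup) {b t : ℝ} (ht : 0 ≤ t) (hbt : Inv b t)
    (G : Finset (Fin I × Fin S)) :
    f (vec G) + (1 - t - (l.map fun i => ∑ s, z i s * k i s).sum) *
        (exclusiveExp f z l (vec G) - f (vec G)) ≤ scanUtility f p c y keep l b G := by
  classical
  have hz0 : ∀ i s, 0 ≤ z i s := fun i s => by
    by_cases h : keep i s
    · rw [hz_keep i s h]; linarith [hy0 i s]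
    · rw [hz_discard i s h]
  have hzp : ∀ i s, z i s ≤ p i s := fun i s => by
    by_cases h : keep i s
    · rw [hz_keep i s h]; linarith [hy0 i s, hyp i s]
    · rw [hz_discard i s h]; linarith [hy0 i s, hyp i s]
  have hz1 : ∀ i, ∑ s, z i s ≤ 1 := fun i => hp1 i ▸ sum_le_sum fun s _ => hzp i s
  have hload : ∀ l : List (Fin I), 0 ≤ (l.map fun i => ∑ s, z i s * k i s).sum := fun l =>
    List.sum_nonneg <| by
      simp only [List.mem_map]
      rintro _ ⟨i, -, rfl⟩
      exact sum_nonneg fun s _ => mul_nonneg (hz0 i s) (hk0 i s)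
  induction l generalizing b t G with
  | nil => simpa [exclusiveExp] using le_scanUtility hf_mono keep hp1 hy0 hyp hl b G
  | cons i l ih =>
    have hgain := sub_nonneg.2 (le_exclusiveExp hf_mono hz0 hz1 (i :: l) (vec G))
    by_cases hθ : 1 - t - ((i :: l).map fun i => ∑ s, z i s * k i s).sum ≤ 0
    · have := mul_nonneg (neg_nonneg.2 hθ) hgain
      linarith [le_scanUtility hf_mono keep hp1 hy0 hyp hl b G (c := c)]
    obtain ⟨hi, hl⟩ := List.nodup_cons.1 hl
    have hkz : 0 ≤ ∑ s, z i s * k i s := sum_nonneg fun s _ => mul_nonneg (hz0 i s) (hk0 i s)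
    have ht1 : t < 1 := by
      have := hload (i :: l)
      linarith
    have hz : ∀ s, (if keep i s ∧ c i s ≤ b then y i s / 4 else 0) = z i s := fun s => by
      by_cases h : keep i s
      · rw [hz_keep i s h]
        rcases ((hy0 i s).trans (hyp i s)).eq_or_lt with hp | hp
        · have : y i s = 0 := le_antisymm (hp ▸ hyp i s) (hy0 i s)
          simp [this]
        · rw [if_pos ⟨h, hInv_afford b t hbt ht1 i s h hp⟩]
      · rw [hz_discard i s h, if_neg fun h' => h h'.1]
    rw [scanUtility_cons keep hp1 hy0 hyp hi]
    simp only [hz]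
    set θ := 1 - t - (l.map fun i => ∑ s, z i s * k i s).sum with hθdef
    have hpick : ∀ s, z i s * (f (vec G ⊔ Pi.single i s.succ) + (θ - k i s) *
        (exclusiveExp f z l (vec G ⊔ Pi.single i s.succ) - f (vec G ⊔ Pi.single i s.succ))) ≤
        z i s * scanUtility f p c y keep l (b - c i s) (insert (i, s) G) := fun s => by
      rcases (hz0 i s).eq_or_lt with h0 | h0
      · simp [← h0]
      have hkeep : keep i s := by
        by_contra h; exact h0.ne' (hz_discard i s h)
      have hcb := hInv_afford b t hbt ht1 i s hkeep (h0.trans_le (hzp i s))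
      refine mul_le_mul_of_nonneg_left ?_ h0.le
      have := ih hl (add_nonneg ht (hk0 i s)) (hInv_pick b t hbt i s hkeep hcb) (insert (i, s) G)
      rw [vec_insert] at this
      have hθs : θ - k i s =
          1 - (t + k i s) - (l.map fun i => ∑ s, z i s * k i s).sum := by rw [hθdef]; ring
      rwa [hθs]
    have hreject := mul_le_mul_of_nonneg_left (ih hl ht hbt G) (sub_nonneg.2 (hz1 i))
    refine le_trans ?_ (add_le_add (sum_le_sum fun s _ => hpick s) hreject)
    have hsingle : Monotone fun s : Fin S => (Pi.single i s.succ : Fin I → Fin (S + 1)) :=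
      fun s t hst => Pi.single_mono i (Fin.succ_le_succ_iff.2 hst)
    have hcheb := chebyshev_cost_value (D := fun s =>
        exclusiveExp f z l (vec G ⊔ Pi.single i s.succ) - f (vec G ⊔ Pi.single i s.succ))
      (D₀ := exclusiveExp f z l (vec G) - f (vec G)) (hz0 i) (hz1 i) (hk0 i) (hk i)
      (fun s t hst => exclusiveExp_gain_antitone hf_sub hz0 hz1 l
        (sup_le_sup_left (hsingle hst) _))
      (fun s => exclusiveExp_gain_antitone hf_sub hz0 hz1 l le_sup_left)
    have hfgain : 0 ≤ ∑ s, z i s * (f (vec G ⊔ Pi.single i s.succ) - f (vec G)) :=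
      sum_nonneg fun s _ => mul_nonneg (hz0 i s) (sub_nonneg.2 (hf_mono le_sup_left))
    have hθ1 : 0 ≤ 1 - (θ - ∑ s, z i s * k i s) := by
      have := hload l
      linarith
    have hprod := mul_nonneg hθ1 hfgain
    have e1 : ∀ s, z i s * (f (vec G ⊔ Pi.single i s.succ) + (θ - k i s) *
        (exclusiveExp f z l (vec G ⊔ Pi.single i s.succ) - f (vec G ⊔ Pi.single i s.succ))) =
        z i s * (f (vec G ⊔ Pi.single i s.succ) - f (vec G)) + z i s * f (vec G) +
          z i s * (exclusiveExp f z l (vec G ⊔ Pi.single i s.succ) -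
            f (vec G ⊔ Pi.single i s.succ)) * θ -
          z i s * k i s * (exclusiveExp f z l (vec G ⊔ Pi.single i s.succ) -
            f (vec G ⊔ Pi.single i s.succ)) := fun s => by ring
    have e2 : exclusiveExp f z (i :: l) (vec G) =
        ∑ s, z i s * (f (vec G ⊔ Pi.single i s.succ) - f (vec G)) + (∑ s, z i s) * f (vec G) +
          ∑ s, z i s * (exclusiveExp f z l (vec G ⊔ Pi.single i s.succ) -
            f (vec G ⊔ Pi.single i s.succ)) +
          (1 - ∑ s, z i s) * exclusiveExp f z l (vec G) := by
      rw [exclusiveExp, sum_mul, ← sum_add_distrib, ← sum_add_distrib]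
      congr 1
      exact sum_congr rfl fun s _ => by ring
    have e3 : 1 - t - ((i :: l).map fun i => ∑ s, z i s * k i s).sum =
        θ - ∑ s, z i s * k i s := by
      rw [List.map_cons, List.sum_cons, hθdef]; ring
    rw [e3, e2]
    simp only [e1, sum_add_distrib, sum_sub_distrib, ← sum_mul]
    linarith

end Scan

/-! ### The guarantee of StoCan -/

section StoCan

variable {I S : ℕ}

/-- `scan` loses at most half of the value of an independent random set, provided that the load
`k` of a pair in the sense of `scanUtility_ge` is dominated by its share of the budget: the
expected total load is then at most `1 / 2`. -/
lemma half_bernoulliExp_le_utility_scan {f : (Fin I → Fin (S + 1)) → ℝ}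
    (hf0 : ∀ u, 0 ≤ f u) (hf_mono : Monotone f) (hf_sub : LatticeSubmodular f)
    {p c y z k : Fin I → Fin S → ℝ} {keep : Fin I → Fin S → Prop} {B : ℝ}
    (hp1 : ∀ i, ∑ s, p i s = 1) (hy0 : ∀ i s, 0 ≤ y i s) (hy : LPFeasible p c B y)
    (hB : 0 ≤ B) (hz_keep : ∀ i s, keep i s → z i s = y i s / 4)
    (hz_discard : ∀ i s, ¬ keep i s → z i s = 0)
    (hk0 : ∀ i s, 0 ≤ k i s) (hk : ∀ i, Monotone (k i))
    (hload : ∀ i s, z i s * k i s ≤ y i s * c i s / (2 * B)) {Inv : ℝ → ℝ → Prop}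
    (hInv : Inv B 0)
    (hInv_afford : ∀ b t, Inv b t → t < 1 → ∀ i s, keep i s → 0 < p i s → c i s ≤ b)
    (hInv_pick : ∀ b t, Inv b t → ∀ i s, keep i s → c i s ≤ b → Inv (b - c i s) (t + k i s)) :
    1 / 2 * bernoulliExp (Function.uncurry z) (setFun f) ≤
      (scan p c y keep (List.finRange I) B).utility f p := by
  have hyp : ∀ i s, y i s ≤ p i s := fun i s => (hy.1 i s).2
  have hz : ∀ i s, 0 ≤ z i s ∧ z i s ≤ p i s := fun i s => by
    have := hy0 i s
    have := hyp i s
    by_cases h : keep i s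
    · rw [hz_keep i s h]; constructor <;> linarith
    · rw [hz_discard i s h]; constructor <;> linarith
  have hz1 : ∀ i, ∑ s, z i s ≤ 1 := fun i => hp1 i ▸ sum_le_sum fun s _ => (hz i s).2
  have h1 := scanUtility_ge hf_mono hf_sub hp1 hy0 hyp hz_keep hz_discard hk0 hk hInv_afford
    hInv_pick (List.nodup_finRange I) le_rfl hInv ∅
  have h2 := bernoulliExp_le_exclusiveExp hf_sub (fun i s => (hz i s).1) hz1
    (List.nodup_finRange I) 0
  have h3 := le_exclusiveExp hf_mono (fun i s => (hz i s).1) hz1 (List.finRange I) 0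
  have h4 : ∑ i, ∑ s, z i s * k i s ≤ 1 / 2 := by
    calc ∑ i, ∑ s, z i s * k i s ≤ ∑ i, ∑ s, y i s * c i s / (2 * B) :=
          sum_le_sum fun i _ => sum_le_sum fun s _ => hload i s
      _ = (∑ i, ∑ s, y i s * c i s) / (2 * B) := by simp only [sum_div]
      _ ≤ 1 / 2 := div_le_of_le_mul₀ (by linarith) (by norm_num) (by linarith [hy.2])
  have h5 : ∀ U : Finset (Fin I × Fin S), (0 : Fin I → Fin (S + 1)) ⊔ vec U = vec U := fun U =>
    sup_eq_right.2 fun j => Fin.zero_le _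
  simp only [List.mem_finRange, if_true, h5] at h2
  rw [vec_empty, ← Fin.sum_univ_def] at h1
  have h6 : bernoulliExp (Function.uncurry z) (setFun f) ≤
    exclusiveExp f z (List.finRange I) 0 := h2
  refine le_trans ?_ h1
  nlinarith [mul_nonneg (sub_nonneg.2 h4) (sub_nonneg.2 h3), hf0 0]

lemma stoCan_admissible {p c y : Fin I → Fin S → ℝ} {B : ℝ} (hy : LPFeasible p c B y) :
    (stoCan p c B y).Admissible := by
  have h := fun keep => scan_admissibleFrom (c := c) keep (fun i s => (hy.1 i s).1)
    (fun i s => (hy.1 i s).2) (List.nodup_finRange I) B (A := ∅) (by simp)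
  exact ⟨by norm_num, h _, h _⟩

lemma stoCan_feasible {p c y : Fin I → Fin S → ℝ} {B : ℝ} (hc0 : ∀ i s, 0 ≤ c i s)
    (hB : 0 ≤ B) : (stoCan p c B y).Feasible c B := by
  rintro φ U (⟨-, h⟩ | ⟨-, h⟩) <;> simpa using scan_cost_le _ hc0 hB h

lemma quarter_bernoulliExp_le_utility_stoCan {f : (Fin I → Fin (S + 1)) → ℝ}
    (hf0 : ∀ u, 0 ≤ f u) (hf_mono : Monotone f) (hf_sub : LatticeSubmodular f)
    {p c y : Fin I → Fin S → ℝ} {B : ℝ} (hp1 : ∀ i, ∑ s, p i s = 1)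
    (hc0 : ∀ i s, 0 ≤ c i s) (hc_mono : ∀ i, Monotone (c i)) (hB : 0 ≤ B)
    (hc_le : ∀ i s, 0 < p i s → c i s ≤ B) (hy : LPFeasible p c B y) :
    1 / 4 * bernoulliExp (fun e => Function.uncurry y e / 4) (setFun f) ≤
      (stoCan p c B y).utility f p := by
  have hy0 : ∀ i s, 0 ≤ y i s := fun i s => (hy.1 i s).1
  have hyp : ∀ i s, y i s ≤ p i s := fun i s => (hy.1 i s).2
  have hple : ∀ i s, p i s ≤ 1 := fun i s =>
    hp1 i ▸ single_le_sum (f := p i) (fun s _ => (hy0 i s).trans (hyp i s)) (mem_univ s)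
  set zs : Fin I → Fin S → ℝ := fun i s => if c i s ≤ B / 2 then y i s / 4 else 0 with hzs
  set zl : Fin I → Fin S → ℝ := fun i s => if B / 2 < c i s then y i s / 4 else 0 with hzl
  have hsmall : 1 / 2 * bernoulliExp (Function.uncurry zs) (setFun f) ≤
      (smallPolicy p c B y).utility f p := by
    -- The load of a pair is its cost relative to `B / 2`.
    refine half_bernoulliExp_le_utility_scan hf0 hf_mono hf_sub hp1 hy0 hy hB
      (k := fun i s => 2 * c i s / B) (Inv := fun b t => b = B - B / 2 * t)
      (fun i s h => if_pos h) (fun i s h => if_neg h)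
      (fun i s => div_nonneg (mul_nonneg zero_le_two (hc0 i s)) hB)
      (fun i s t hst => div_le_div_of_nonneg_right
        (mul_le_mul_of_nonneg_left (hc_mono i hst) zero_le_two) hB)
      (fun i s => ?_) (by ring) ?_ ?_
    · have h : zs i s ≤ y i s / 4 := by
        have := hy0 i s
        simp only [hzs]; split_ifs <;> linarith
      refine (mul_le_mul_of_nonneg_right h
        (div_nonneg (mul_nonneg zero_le_two (hc0 i s)) hB)).trans_eq ?_
      rcases eq_or_ne B 0 with h0 | h0
      · simp [h0]
      · field_simp; norm_num
    · rintro b t rfl ht i s hs -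
      nlinarith [hs]
    · rintro b t rfl i s hs hcb
      rcases eq_or_ne B 0 with h0 | h0
      · subst h0
        have := hc0 i s
        norm_num at hcb ⊢
        linarith
      · field_simp; ring
  have hlarge : 1 / 2 * bernoulliExp (Function.uncurry zl) (setFun f) ≤
      (largePolicy p c B y).utility f p := by
    -- The load of a pair is `1`: one pick ends the scan, and any first pick is affordable.
    refine half_bernoulliExp_le_utility_scan hf0 hf_mono hf_sub hp1 hy0 hy hB
      (k := fun i s => if B / 2 < c i s then 1 else 0)
      (Inv := fun b t => 0 ≤ t ∧ (t < 1 → b = B))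
      (fun i s h => if_pos h) (fun i s h => if_neg h)
      (fun i s => by split_ifs <;> norm_num)
      (fun i s t hst => ?_) (fun i s => ?_) ⟨le_rfl, fun _ => rfl⟩ ?_ ?_
    · dsimp only
      by_cases h : B / 2 < c i s
      · rw [if_pos h, if_pos (h.trans_le (hc_mono i hst))]
      · rw [if_neg h]; split_ifs <;> norm_num
    · have hnonneg : 0 ≤ y i s * c i s / (2 * B) :=
        div_nonneg (mul_nonneg (hy0 i s) (hc0 i s)) (by linarith)
      simp only [hzl]
      split_ifs with h
      · rcases hB.eq_or_lt with h0 | h0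
        -- If `B = 0` then `c i s > 0 = B` forces `p i s = 0`, hence `y i s = 0`.
        · have hp : p i s ≤ 0 := by
            by_contra hp
            have := hc_le i s (not_le.1 hp)
            linarith
          have : y i s = 0 := le_antisymm ((hyp i s).trans hp) (hy0 i s)
          simp [this]
        · rw [mul_one, le_div_iff₀ (by linarith)]
          nlinarith [mul_nonneg (hy0 i s) (sub_nonneg.2 h.le)]
      · simpa using hnonneg
    · rintro b t ⟨-, hb⟩ ht i s - hp
      rw [hb ht]
      exact hc_le i s hp
    · rintro b t ⟨ht, -⟩ i s hs -
      rw [if_pos hs]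
      exact ⟨by linarith, fun h => absurd h (by linarith)⟩
  have hsum : (fun e => Function.uncurry y e / 4) = Function.uncurry zs + Function.uncurry zl := by
    funext ⟨i, s⟩
    rcases le_or_gt (c i s) (B / 2) with h | h
    · simp [hzs, hzl, Function.uncurry, h, not_lt.2 h]
    · simp [hzs, hzl, Function.uncurry, h, not_le.2 h]
  have hadd := hf_sub.setSubmodular.bernoulliExp_add_le (fun U => hf0 _)
    (a := Function.uncurry zs) (b := Function.uncurry zl)
    (fun e => by
      have := hy0 e.1 e.2
      simp only [hzs, Function.uncurry, Pi.zero_apply]; split_ifs <;> linarith)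
    (fun e => by
      have := hy0 e.1 e.2
      simp only [hzl, Function.uncurry, Pi.zero_apply]; split_ifs <;> linarith)
    (by
      rw [← hsum]
      intro e
      have := hy0 e.1 e.2
      have := hyp e.1 e.2
      have := hple e.1 e.2
      simp only [Function.uncurry, Pi.one_apply]; linarith)
  have hutil : (stoCan p c B y).utility f p =
      1 / 2 * (smallPolicy p c B y).utility f p +
        (1 - 1 / 2) * (largePolicy p c B y).utility f p := by
    change stateExp p (fun φ => _) = 1 / 2 * stateExp p _ + (1 - 1 / 2) * stateExp p _
    rw [← stateExp_const_mul, ← stateExp_const_mul, ← stateExp_add]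
    rfl
  rw [hutil, hsum]
  linarith

lemma Policy.utility_nonneg {f : (Fin I → Fin (S + 1)) → ℝ} (hf0 : ∀ u, 0 ≤ f u)
    {p : Fin I → Fin S → ℝ} (hp0 : ∀ i s, 0 ≤ p i s) (hp1 : ∀ i, ∑ s, p i s = 1)
    {π : Policy I S} (hπ : π.Admissible) : 0 ≤ π.utility f p := by
  rw [← stateExp_const hp1 0]
  refine stateExp_mono hp0 fun φ => ?_
  rw [← Policy.value_const φ 0 π ∅]
  exact Policy.value_le_of_outcomes hπ fun U _ => hf0 _

lemma Policy.utility_of_no_items (f : (Fin 0 → Fin (S + 1)) → ℝ) (p : Fin 0 → Fin S → ℝ)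
    (π : Policy 0 S) : π.utility f p = f 0 := by
  have h : setFun f = fun _ => f 0 := by
    funext U; exact congrArg f (Subsingleton.elim _ _)
  change stateExp p (fun φ => Policy.value φ (setFun f) π ∅) = f 0
  simp only [h, Policy.value_const]
  exact stateExp_const (fun i => i.elim0) _

end StoCan

end StochProbing

theorem theorem1 {I S : ℕ}
    (f : (Fin I → Fin (S + 1)) → ℝ)
    (hf_nonneg : ∀ u, 0 ≤ f u) (hf_mono : Monotone f)
    (hf_sub : StochProbing.LatticeSubmodular f)
    (p : Fin I → Fin S → ℝ)
    (hp_nonneg : ∀ i s, 0 ≤ p i s) (hp_sum : ∀ i, ∑ s, p i s = 1)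
    (c : Fin I → Fin S → ℝ)
    (hc_nonneg : ∀ i s, 0 ≤ c i s) (hc_mono : ∀ i, Monotone (c i))
    (B : ℝ) (hB : 0 ≤ B) (hc_le : ∀ i s, 0 < p i s → c i s ≤ B) :
    (∃ y, StochProbing.ContinuousGreedyOutput f p c B y) ∧
    ∀ y, StochProbing.ContinuousGreedyOutput f p c B y →
      (StochProbing.stoCan p c B y).Admissible ∧
      (StochProbing.stoCan p c B y).Feasible c B ∧
      ∀ π : StochProbing.Policy I S, π.Admissible → π.Feasible c B →
        (1 - 1 / Real.exp 1) / 16 * π.utility f p ≤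
          (StochProbing.stoCan p c B y).utility f p := by
  refine ⟨StochProbing.exists_continuousGreedyOutput f hp_nonneg hB, fun y hy => ?_⟩
  have hy' := hy.lpFeasible hp_nonneg hB
  refine ⟨StochProbing.stoCan_admissible hy', StochProbing.stoCan_feasible hc_nonneg hB,
    fun π hπ hπB => ?_⟩
  rcases Nat.eq_zero_or_pos I with rfl | hI
  · rw [StochProbing.Policy.utility_of_no_items, StochProbing.Policy.utility_of_no_items]
    have : 0 < 1 / Real.exp 1 := by positivity
    nlinarith [hf_nonneg 0]
  · have h1 := hy.value_ge hf_nonneg hf_mono hf_sub hp_nonneg hp_sum hI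
      (StochProbing.Policy.utility_nonneg hf_nonneg hp_nonneg hp_sum hπ)
      fun y x hy0 hy1 hx => StochProbing.Policy.utility_le_of_lpOptimal hf_mono hf_sub hp_nonneg
        hp_sum hy0 hy1 hx hπ hπB
    have h2 := StochProbing.quarter_bernoulliExp_le_utility_stoCan hf_nonneg hf_mono hf_sub hp_sum
      hc_nonneg hc_mono hB hc_le hy'
    linarith
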